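/- Let $n\ge 1$ and let $V:\mathbb{R}\to\mathbb{R}$ be $C^{2n+1}$ and such that $\mu(dx)=e^{-V(x)}dx$ is a probability measure on $\mathbb{R}$. Write $D\phi=\phi'$, $D^*=-D+V'$ (the adjoint of $D$ in $L^2(\mu)$), and let $\langle\cdot,\cdot\rangle$ and $\|\cdot\|$ be the inner product and norm of $L^2(\mu)$. For a positive function $E$ put $$\mathcal{A}(E)=\tfrac14\Big(2E''+2V'E'-\frac{(E')^2}{E}+4E\,V''\Big),$$ and define $$E_1=V'',\qquad E_k=E_{k-1}\big(1+\mathcal{A}(E_{k-1}^{-1})\big)\quad(k\ge 2),$$ where $E_k$ is defined as long as $E_{k-1}$ is defined and positive. For a function $f$ put $$f_1=f',\qquad f_k=E_{k-1}^{1/2}\,D\big[E_{k-1}^{-1}f_{k-1}\big]\quad(k\ge 2).$$ For a positive function $E$ let $DE^{-1}D^*$ denote the non-negative self-adjoint operator $\overline{S}\,S^*$ in $L^2(\mu)$, where $S=DE^{-1/2}$ is defined on the functions $E^{1/2}\zeta$ with $\zeta\in C^1_c(\mathbb{R})$ (that is, $S(E^{1/2}\zeta)=\zeta'$), $\overline S=S^{**}$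 is its closure and $S^*=E^{-1/2}D^*$ its adjoint. Theorem. Suppose that $E_1,E_2,\dots,E_n$ are positive on $\mathbb{R}$ (in particular $V$ is convex). Then $I+DE_n^{-1}D^*$ has a bounded everywhere defined inverse on $L^2(\mu)$, and for every compactly supported $f\in C^{n+1}(\mathbb{R})$ the functions $E_k^{-1/2}f_k$ $(1\le k\le n)$ and $D[E_n^{-1}f_n]$ are in $L^2(\mu)$ and $$\mathrm{Var}_\mu(f)=\sum_{k=1}^{n}(-1)^{k-1}\big\|E_k^{-1/2}f_k\big\|^2+(-1)^n\Big\langle (I+DE_n^{-1}D^*)^{-1}D[E_n^{-1}f_n],\,D[E_n^{-1}f_n]\Big\rangle .$$ In particular, if $n$ is even, then $\mathrm{Var}_\mu(f)\ge\sum_{k=1}^{n}(-1)^{k-1}\|E_k^{-1/2}f_k\|^2$, and if $n$ is odd, then $\mathrm{Var}_\mu(f)\le\sum_{k=1}^{n}(-1)^{k-1}\|E_k^{-1/2}f_k\|^2$. -/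

import Mathlib

open MeasureTheory Filter
open scoped ENNReal

noncomputable section

namespace BrascampLieb

/-- The measure `μ(dx) = e^{-V(x)} dx` on the real line. -/
def gibbs (V : ℝ → ℝ) : Measure ℝ :=
  volume.withDensity fun x => ENNReal.ofReal (Real.exp (-V x))

/-- The real Hilbert space `L²(μ)`, `μ(dx) = e^{-V(x)} dx`. -/
abbrev L2 (V : ℝ → ℝ) : Type := Lp ℝ 2 (gibbs V)

/-- `𝒜(E) = (1/4) (2 E'' + 2 V' E' - (E')² / E + 4 E V'')`. -/
def calA (V E : ℝ → ℝ) (x : ℝ) : ℝ :=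
  (1 / 4) * (2 * deriv (deriv E) x + 2 * deriv V x * deriv E x
    - (deriv E x) ^ 2 / E x + 4 * E x * deriv (deriv V) x)

/-- `E₁ = V''` and `Eₖ₊₁ = Eₖ (1 + 𝒜(Eₖ⁻¹))`. The sequence starts at index `1`;
the value at index `0` is never used. -/
def seqE (V : ℝ → ℝ) : ℕ → ℝ → ℝ
  | 0 => fun _ => 1
  | 1 => deriv (deriv V)
  | (k + 2) => fun x =>
      seqE V (k + 1) x * (1 + calA V (fun y => (seqE V (k + 1) y)⁻¹) x)

/-- `f₁ = f'` and `fₖ₊₁ = Eₖ^{1/2} D[Eₖ⁻¹ fₖ]`. The sequence starts at index `1`;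
the value at index `0` is never used. -/
def seqF (V f : ℝ → ℝ) : ℕ → ℝ → ℝ
  | 0 => f
  | 1 => deriv f
  | (k + 2) => fun x =>
      Real.sqrt (seqE V (k + 1) x) *
        deriv (fun y => (seqE V (k + 1) y)⁻¹ * seqF V f (k + 1) y) x

/-- `D[Eₖ⁻¹ fₖ]`. -/
def remF (V f : ℝ → ℝ) (k : ℕ) : ℝ → ℝ :=
  deriv fun y => (seqE V k y)⁻¹ * seqF V f k y

/-- The graph in `L²(μ) × L²(μ)` of the operator `S = D E^{-1/2}` on the functions `E^{1/2} ζ`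
with `ζ` continuously differentiable and compactly supported, that is, `S (E^{1/2} ζ) = ζ'`. -/
def graphS (V E : ℝ → ℝ) : Submodule ℝ (L2 V × L2 V) where
  carrier := {p | ∃ ζ : ℝ → ℝ, ContDiff ℝ 1 ζ ∧ HasCompactSupport ζ ∧
    (p.1 =ᵐ[gibbs V] fun x => Real.sqrt (E x) * ζ x) ∧ (p.2 =ᵐ[gibbs V] deriv ζ)}
  zero_mem' := by
    refine ⟨fun _ => 0, contDiff_const, HasCompactSupport.zero, ?_, ?_⟩
    · filter_upwards [Lp.coeFn_zero ℝ 2 (gibbs V)] with x hx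
      simpa using hx
    · filter_upwards [Lp.coeFn_zero ℝ 2 (gibbs V)] with x hx
      simpa using hx
  add_mem' := by
    rintro ⟨a, b⟩ ⟨c, d⟩ ⟨ζ, h1, h2, h3, h4⟩ ⟨ξ, k1, k2, k3, k4⟩
    refine ⟨ζ + ξ, h1.add k1, h2.add k2, ?_, ?_⟩
    · filter_upwards [Lp.coeFn_add a c, h3, k3] with x hx ha hc
      simp only [Prod.mk_add_mk, hx, Pi.add_apply] at *
      rw [ha, hc]; ring
    · filter_upwards [Lp.coeFn_add b d, h4, k4] with x hx ha hc
      simp only [Prod.mk_add_mk, hx, Pi.add_apply] at *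
      rw [ha, hc, deriv_add (h1.differentiable one_ne_zero x) (k1.differentiable one_ne_zero x)]
  smul_mem' := by
    rintro r ⟨a, b⟩ ⟨ζ, h1, h2, h3, h4⟩
    refine ⟨fun x => r * ζ x, contDiff_const.mul h1, h2.mul_left, ?_, ?_⟩
    · filter_upwards [Lp.coeFn_smul r a, h3] with x hx ha
      simp only [Prod.smul_mk, hx, Pi.smul_apply, smul_eq_mul] at *
      rw [ha]; ring
    · filter_upwards [Lp.coeFn_smul r b, h4] with x hx ha
      simp only [Prod.smul_mk, hx, Pi.smul_apply, smul_eq_mul] at *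
      rw [ha, deriv_const_mul r (h1.differentiable one_ne_zero x)]

/-- The non-negative self-adjoint operator `D E⁻¹ D* = S** S*` in `L²(μ)`, where `S = D E^{-1/2}`
(so `S* = E^{-1/2} D*`, with `D* = -D + V'` in the weak sense, and `S**` is the closure of `S`):
`IsDEDstar V E u a` says that `u` is in its domain and is mapped to `a`. -/
def IsDEDstar (V E : ℝ → ℝ) (u a : L2 V) : Prop :=
  ∃ w : L2 V, (u, w) ∈ (graphS V E).adjoint ∧ (w, a) ∈ (graphS V E).adjoint.adjoint

/-- `R` is the everywhere defined bounded two-sided inverse of `I + D E⁻¹ D*`: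
`R g = u` if and only if `u` is in the domain and `u + D E⁻¹ D* u = g`. -/
def IsInverse (V E : ℝ → ℝ) (R : L2 V →L[ℝ] L2 V) : Prop :=
  ∀ u g : L2 V, R g = u ↔ IsDEDstar V E u (g - u)

/-- `∑_{k=1}^{n} (-1)^{k-1} ‖Eₖ^{-1/2} fₖ‖²` with the norm of `L²(μ)`. -/
def altSum (V f : ℝ → ℝ) (n : ℕ) : ℝ :=
  ∑ k ∈ Finset.Icc 1 n,
    (-1 : ℝ) ^ (k - 1) * ∫ x, ((Real.sqrt (seqE V k x))⁻¹ * seqF V f k x) ^ 2 ∂(gibbs V)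

end BrascampLieb

end

/-! The expansion comes from iterating one equation, `(D* D + E_k) y_k = f_k`. Solving `D* y_1 = f -
∫ f dμ` and differentiating gives the case `k = 1`, because `D D* = D* D + V''`; integration by
parts gives `Var f = ⟨y_1, f_1⟩`.

Since `y_k = E_k⁻¹ f_k - E_k⁻¹ D* D y_k`, one has `⟨y_k, f_k⟩ = ‖E_k^{-1/2} f_k‖² - ⟨y_k', D[E_k⁻¹
f_k]⟩`. Differentiating the same relation shows that `u = y_k'` solves `u + D E_k⁻¹ D* u = D[E_k⁻¹
f_k]`. Conjugation by `a = E_k^{-1/2}` turns this into `(D* D + E_{k+1}) y_{k+1} = f_{k+1}` with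
`y_{k+1} = a u`; this is where the recursion for `E_k` comes from. The last pairing is `⟨y_{k+1},
f_{k+1}⟩`, so the step repeats with the opposite sign. At `k = n` it stops: `y_n'` is identified
with `(I + D E_n⁻¹ D*)⁻¹ D[E_n⁻¹ f_n]`, and the inverse is non-negative.

The analytic difficulty is the behaviour at infinity, where nothing is assumed on `V`. Each `y_k`
must have finite energy: `y_k'` and `E_k^{1/2} y_k` in `L²(μ)`. `tendsto_flux_atTop` shows by an ODE
argument that the flux `e^{-V} y_k'` vanishes at infinity; `integrable_energy_of_flux` then
truncates in the value of the flux to transfer finite energy to `y_{k+1}`.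
`mem_graphS_adjoint_adjoint` puts finite-energy functions in the domain of the closure of `S`, as
the last step needs. -/

/-! ### The inverse of `I + G** G*` as an orthogonal projection. -/

/-- Von Neumann's theorem for a linear relation `G` in a real Hilbert space:
`I + G** G*` has an everywhere defined bounded inverse, which is non-negative. -/
theorem exists_inverse_one_add_adjoint {H : Type*} [NormedAddCommGroup H] [InnerProductSpace ℝ H]
    [CompleteSpace H] (G : Submodule ℝ (H × H)) :
    ∃ R : H →L[ℝ] H,
      (∀ u g : H, R g = u ↔ ∃ w, (u, w) ∈ G.adjoint ∧ (w, g - u) ∈ G.adjoint.adjoint) ∧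
      ∀ g, 0 ≤ inner ℝ (R g) g := by
  let e : WithLp 2 (H × H) ≃L[ℝ] H × H := WithLp.prodContinuousLinearEquiv 2 ℝ H H
  obtain ⟨A, hAc, hA⟩ : ∃ A : Submodule ℝ (WithLp 2 (H × H)), IsClosed (A : Set (WithLp 2 (H × H))) ∧
      ∀ p : H × H, p ∈ G.adjoint ↔ WithLp.toLp 2 p ∈ A := by
    -- The adjoint relation is an orthogonal complement in the Hilbert product, hence closed, so it
    -- admits an orthogonal projection.
    refine ⟨(G.map ((LinearEquiv.skewSwap ℝ H H).symm.trans
      (WithLp.linearEquiv 2 ℝ (H × H)).symm).toLinearMap).orthogonal,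
      Submodule.isClosed_orthogonal _, fun p => ?_⟩
    simp only [Submodule.adjoint, Submodule.mem_map]
    constructor
    · rintro ⟨y, hy, rfl⟩
      exact hy
    · intro h
      exact ⟨_, h, rfl⟩
  have : CompleteSpace A := hAc.completeSpace_coe
  -- `(w, g - u) ∈ G**` means `(g, 0) - (u, w) ⊥ G*`. Together with `(u, w) ∈ G*` this says that
  -- `(u, w)` is the projection of `(g, 0)`, so `R g` has to be its first component.
  have hA2 : ∀ u w g : H, (w, g - u) ∈ G.adjoint.adjoint ↔
      ∀ v ∈ A, inner ℝ (WithLp.toLp 2 (g, (0 : H)) - WithLp.toLp 2 (u, w)) v = 0 := by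
    intro u w g
    rw [Submodule.mem_adjoint_iff]
    constructor
    · intro h v hv
      have h1 := h v.fst v.snd ((hA _).2 hv)
      simp only [WithLp.prod_inner_apply]
      simp only [WithLp.ofLp_sub, Prod.fst_sub, Prod.snd_sub, zero_sub, inner_neg_left]
      change inner ℝ v.snd w - inner ℝ v.fst (g - u) = 0 at h1
      rw [real_inner_comm w, real_inner_comm (g - u)] at h1
      change inner ℝ (g - u) v.fst + -inner ℝ w v.snd = 0
      linarith
    · intro h a b hab
      have h1 := h _ ((hA _).1 hab)
      simp only [WithLp.prod_inner_apply] at h1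
      simp only [WithLp.ofLp_sub, Prod.fst_sub, Prod.snd_sub, zero_sub, inner_neg_left] at h1
      change inner ℝ b w - inner ℝ a (g - u) = 0
      change inner ℝ (g - u) a + -inner ℝ w b = 0 at h1
      rw [real_inner_comm w, real_inner_comm (g - u)] 
      linarith
  let ι : H →L[ℝ] WithLp 2 (H × H) :=
    (e.symm : H × H →L[ℝ] WithLp 2 (H × H)).comp (ContinuousLinearMap.inl ℝ H H)
  let π : WithLp 2 (H × H) →L[ℝ] H :=
    (ContinuousLinearMap.fst ℝ H H).comp (e : WithLp 2 (H × H) →L[ℝ] H × H)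
  have hι : ∀ g, ι g = WithLp.toLp 2 (g, (0 : H)) := fun g => rfl
  have hπ : ∀ p, π p = p.fst := fun p => rfl
  refine ⟨π.comp (A.starProjection.comp ι), fun u g => ⟨?_, ?_⟩, fun g => ?_⟩
  · rintro rfl
    refine ⟨(A.starProjection (ι g)).snd, ?_, ?_⟩
    · rw [hA]
      exact A.starProjection_apply_mem (ι g)
    · rw [hA2]
      intro v hv
      exact A.starProjection_inner_eq_zero (ι g) v hv
  · rintro ⟨w, h1, h2⟩
    have h3 := Submodule.eq_starProjection_of_mem_of_inner_eq_zero ((hA _).1 h1) ((hA2 _ _ _).1 h2)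
    change (A.starProjection (ι g)).fst = u
    rw [hι, h3]
    rfl
  -- `⟨R g, g⟩` is the squared norm of the projection of `(g, 0)`.
  · have h1 := A.starProjection_inner_eq_zero (ι g) _ (A.starProjection_apply_mem (ι g))
    have h2 : inner ℝ (π (A.starProjection (ι g))) g
        = inner ℝ (ι g) (A.starProjection (ι g)) := by
      rw [hπ, hι, WithLp.prod_inner_apply]
      simp [real_inner_comm]
    change 0 ≤ inner ℝ (π (A.starProjection (ι g))) g
    rw [h2]
    rw [inner_sub_left, sub_eq_zero] at h1
    rw [h1]
    exact real_inner_self_nonneg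

namespace BrascampLieb

/-! ### Integration by parts for `μ`. -/

section Weight

variable {V : ℝ → ℝ}

theorem integrable_gibbs_iff (hV : Continuous V) {g : ℝ → ℝ} :
    Integrable g (gibbs V) ↔ Integrable fun x => Real.exp (-V x) * g x := by
  have hm : Measurable fun x => ENNReal.ofReal (Real.exp (-V x)) :=
    (Real.continuous_exp.comp hV.neg).measurable.ennreal_ofReal
  rw [gibbs, integrable_withDensity_iff_integrable_smul' hm (by simp)]
  simp [ENNReal.toReal_ofReal (Real.exp_pos _).le]

theorem integral_gibbs (hV : Continuous V) (g : ℝ → ℝ) :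
    ∫ x, g x ∂gibbs V = ∫ x, Real.exp (-V x) * g x := by
  have hm : Measurable fun x => ENNReal.ofReal (Real.exp (-V x)) :=
    (Real.continuous_exp.comp hV.neg).measurable.ennreal_ofReal
  rw [gibbs, integral_withDensity_eq_integral_toReal_smul hm (by simp)]
  simp [ENNReal.toReal_ofReal (Real.exp_pos _).le]

theorem gibbs_absolutelyContinuous : gibbs V ≪ volume :=
  withDensity_absolutelyContinuous _ _

theorem integrable_gibbs_of_hasCompactSupport [IsFiniteMeasure (gibbs V)] {g : ℝ → ℝ}
    (hg : Continuous g) (hc : HasCompactSupport g) : Integrable g (gibbs V) :=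
  hg.integrable_of_hasCompactSupport hc

/-- `D* φ` has zero mean for `φ` continuously differentiable with compact support. -/
theorem integral_dstar_eq_zero (hV : ContDiff ℝ 1 V) {φ : ℝ → ℝ} (hφ : ContDiff ℝ 1 φ)
    (hc : HasCompactSupport φ) : ∫ x, (deriv V x * φ x - deriv φ x) ∂gibbs V = 0 := by
  have hV0 : Continuous V := hV.continuous
  have hV1 : Continuous (deriv V) := hV.continuous_deriv le_rfl
  have hφ1 : Continuous (deriv φ) := hφ.continuous_deriv le_rfl
  rw [integral_gibbs hV.continuous]
  refine integral_eq_zero_of_hasDerivAt_of_integrable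
    (f := fun x => -(Real.exp (-V x) * φ x)) (fun x => ?_) ?_ ?_
  · have h1 := (hV.differentiable one_ne_zero x).hasDerivAt
    have h2 := (hφ.differentiable one_ne_zero x).hasDerivAt
    refine (h1.neg.exp.mul h2).neg.congr_deriv ?_
    simp only [Pi.neg_apply]
    ring
  · refine Continuous.integrable_of_hasCompactSupport (by fun_prop) ?_
    exact ((hc.mul_left (f := deriv V)).sub hc.deriv).mul_left
  · refine Continuous.integrable_of_hasCompactSupport (by fun_prop) ?_
    exact (hc.mul_left (f := fun x => Real.exp (-V x))).neg

/-- Integration by parts in `L²(μ)`. -/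
theorem integral_deriv_mul_gibbs [IsFiniteMeasure (gibbs V)] (hV : ContDiff ℝ 1 V)
    {φ u : ℝ → ℝ} (hφ : ContDiff ℝ 1 φ) (hu : ContDiff ℝ 1 u) (hc : HasCompactSupport φ) :
    ∫ x, deriv φ x * u x ∂gibbs V = ∫ x, φ x * (deriv V x * u x - deriv u x) ∂gibbs V := by
  have hV1 : Continuous (deriv V) := hV.continuous_deriv le_rfl
  have hφ1 : Continuous (deriv φ) := hφ.continuous_deriv le_rfl
  have hu1 : Continuous (deriv u) := hu.continuous_deriv le_rfl
  have hφ0 := hφ.continuous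
  have hu0 := hu.continuous
  have h := integral_dstar_eq_zero hV (hφ.mul hu) hc.mul_right
  rw [← sub_eq_zero, ← neg_eq_zero, ← integral_sub, ← integral_neg, ← h]
  · refine integral_congr_ae (Eventually.of_forall fun x => ?_)
    have h1 := (hφ.differentiable one_ne_zero x).hasDerivAt
    have h2 := (hu.differentiable one_ne_zero x).hasDerivAt
    have h3 : deriv (fun x => φ x * u x) x = deriv φ x * u x + φ x * deriv u x :=
      (h1.mul h2).deriv
    simp only [h3]
    ring
  · exact integrable_gibbs_of_hasCompactSupport (by fun_prop) hc.deriv.mul_right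
  · exact integrable_gibbs_of_hasCompactSupport (by fun_prop) hc.mul_right

end Weight

/-! ### Decay of the flux at infinity. -/

/-- If `1/ρ` is integrable near `+∞` then `ρ` is not. -/
theorem not_integrableOn_of_integrableOn_inv {ρ : ℝ → ℝ} (hρ : ∀ x, 0 < ρ x) {a : ℝ}
    (h : IntegrableOn (fun x => (ρ x)⁻¹) (Set.Ioi a)) : ¬ IntegrableOn ρ (Set.Ioi a) := by
  intro h2
  -- `ρ⁻¹ + ρ ≥ 1`, and the constant `1` is not integrable on a half-line.
  have h3 : IntegrableOn (fun _ : ℝ => (1 : ℝ)) (Set.Ioi a) := by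
    refine (h.add h2).mono' aestronglyMeasurable_const (Eventually.of_forall fun x => ?_)
    have := hρ x
    have h4 : (ρ x)⁻¹ * ρ x = 1 := inv_mul_cancel₀ this.ne'
    have h5 : 0 < (ρ x)⁻¹ := inv_pos.2 this
    simp only [norm_one, Pi.add_apply]
    nlinarith [sq_nonneg ((ρ x)⁻¹ - ρ x)]
  simp [integrableOn_const_iff] at h3

/-- Decay at `+∞` of the flux of a solution of finite energy of a homogeneous equation. -/
theorem tendsto_flux_atTop {ρ κ y s : ℝ → ℝ} {a : ℝ} (hρ : ∀ x, 0 < ρ x)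
    (hρi : Integrable fun x => (ρ x)⁻¹) (hρm : Continuous ρ) (hκ : ∀ x, 0 ≤ κ x)
    (hy : ∀ x, a < x → HasDerivAt y (ρ x * s x) x)
    (hs : ∀ x, a < x → HasDerivAt s (κ x * y x) x)
    (hi : Integrable fun x => ρ x * s x ^ 2) : Tendsto s atTop (nhds 0) := by
  -- A lower bound `c ≤ s²` near `+∞` would give `ρ ≤ c⁻¹ ρ s²`, making `ρ` integrable there.
  have key : ∀ b c : ℝ, 0 < c → ¬ ∀ x, b < x → c ≤ s x ^ 2 := by
    intro b c hc h
    refine not_integrableOn_of_integrableOn_inv hρ (a := b) hρi.integrableOn ?_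
    have h1 : IntegrableOn (fun x => c⁻¹ * (ρ x * s x ^ 2)) (Set.Ioi b) :=
      (hi.const_mul _).integrableOn
    refine h1.mono' hρm.aestronglyMeasurable ?_
    filter_upwards [ae_restrict_mem measurableSet_Ioi] with x hx
    rw [Real.norm_of_nonneg (hρ x).le, mul_left_comm]
    have h2 : 1 ≤ c⁻¹ * s x ^ 2 := by
      rw [inv_mul_eq_div, one_le_div hc]
      exact h x hx
    exact le_mul_of_one_le_right (hρ x).le h2
  have hd : ∀ x, a < x →
      HasDerivAt (fun x => s x ^ 2) (2 * κ x * (y x * s x)) x := by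
    intro x hx
    refine ((hs x hx).pow 2).congr_deriv ?_
    push_cast
    ring
  -- `(y s)' = ρ s² + κ y² ≥ 0`. As `(s²)' = 2 κ y s`, either `y s` becomes positive and `s²` is
  -- nondecreasing from there, which `key` excludes, or `s²` is nonincreasing throughout and `key`
  -- forces its limit to be zero.
  have hmono : MonotoneOn (fun x => y x * s x) (Set.Ioi a) := by
    have hd' : ∀ x ∈ Set.Ioi a, HasDerivAt (fun x => y x * s x)
        (ρ x * s x * s x + y x * (κ x * y x)) x := fun x hx => (hy x hx).mul (hs x hx)
    refine monotoneOn_of_deriv_nonneg (convex_Ioi a)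
      (fun x hx => (hd' x hx).continuousAt.continuousWithinAt) ?_ ?_
    · intro x hx
      rw [interior_Ioi] at hx
      exact (hd' x hx).differentiableAt.differentiableWithinAt
    · intro x hx
      rw [interior_Ioi] at hx
      rw [(hd' x hx).deriv]
      nlinarith [mul_nonneg (hρ x).le (sq_nonneg (s x)), mul_nonneg (hκ x) (sq_nonneg (y x))]
  by_cases hpos : ∃ b, a < b ∧ 0 < y b * s b
  · obtain ⟨b, hab, hb⟩ := hpos
    exfalso
    refine key b (s b ^ 2) (by
      have : s b ≠ 0 := by rintro h; simp [h] at hb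
      positivity) fun x hx => ?_
    have hm : MonotoneOn (fun x => s x ^ 2) (Set.Ici b) := by
      refine monotoneOn_of_deriv_nonneg (convex_Ici b)
        (fun x hx => (hd x (hab.trans_le hx)).continuousAt.continuousWithinAt) ?_ ?_
      · intro x hx
        rw [interior_Ici] at hx
        exact (hd x (hab.trans hx)).differentiableAt.differentiableWithinAt
      · intro x hx
        rw [interior_Ici] at hx
        rw [(hd x (hab.trans hx)).deriv]
        have := hmono (Set.mem_Ioi.2 hab) (Set.mem_Ioi.2 (hab.trans hx)) hx.le
        have h0 := hκ x
        simp only at this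
        have : 0 ≤ y x * s x := hb.le.trans this
        positivity
    exact hm (Set.mem_Ici.2 le_rfl) (Set.mem_Ici.2 hx.le) hx.le
  · push Not at hpos
    have hm : AntitoneOn (fun x => s x ^ 2) (Set.Ioi a) := by
      refine antitoneOn_of_deriv_nonpos (convex_Ioi a)
        (fun x hx => (hd x hx).continuousAt.continuousWithinAt) ?_ ?_
      · intro x hx
        rw [interior_Ioi] at hx
        exact (hd x hx).differentiableAt.differentiableWithinAt
      · intro x hx
        rw [interior_Ioi] at hx
        rw [(hd x hx).deriv]
        have := hpos x hx
        have h0 := hκ x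
        exact mul_nonpos_of_nonneg_of_nonpos (by positivity) this
    rw [Metric.tendsto_atTop]
    intro ε hε
    have := key a (ε ^ 2) (by positivity)
    push Not at this
    obtain ⟨b, hab, hb⟩ := this
    refine ⟨b, fun x hx => ?_⟩
    have h1 : s x ^ 2 ≤ s b ^ 2 := hm hab (hab.trans_le hx) hx
    rw [Real.dist_eq, sub_zero]
    exact abs_lt_of_sq_lt_sq (h1.trans_lt hb) hε.le

/-- Two-sided version of `tendsto_flux_atTop`. -/
theorem tendsto_flux_cocompact {ρ κ y s : ℝ → ℝ} {a : ℝ} (hρ : ∀ x, 0 < ρ x)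
    (hρi : Integrable fun x => (ρ x)⁻¹) (hρm : Continuous ρ) (hκ : ∀ x, 0 ≤ κ x)
    (hy : ∀ x, HasDerivAt y (ρ x * s x) x)
    (hs : ∀ x, a < |x| → HasDerivAt s (κ x * y x) x)
    (hi : Integrable fun x => ρ x * s x ^ 2) : Tendsto s (cocompact ℝ) (nhds 0) := by
  rw [cocompact_eq_atBot_atTop, tendsto_sup]
  refine ⟨?_, tendsto_flux_atTop hρ hρi hρm hκ (fun x _ => hy x)
    (fun x hx => hs x (hx.trans_le (le_abs_self x))) hi⟩
  have h := tendsto_flux_atTop (ρ := fun x => ρ (-x)) (κ := fun x => κ (-x))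
    (y := fun x => y (-x)) (s := fun x => -s (-x)) (a := a) (fun x => hρ _) hρi.comp_neg
    (by fun_prop) (fun x => hκ _) ?_ ?_ ?_
  · have h2 := (h.comp tendsto_neg_atBot_atTop).neg
    simpa [Function.comp_def] using h2
  · intro x _
    refine ((hy (-x)).scomp x (hasDerivAt_neg x)).congr_deriv ?_
    simp
  · intro x hx
    refine ((hs (-x) ?_).scomp x (hasDerivAt_neg x)).neg.congr_deriv ?_
    · rw [abs_neg]; exact hx.trans_le (le_abs_self x)
    · simp
  · simpa using hi.comp_neg

/-! ### Truncation and transfer of finite energy. -/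

/-- A differentiable function has zero derivative at almost every zero. -/
theorem ae_deriv_eq_zero_of_eq_zero {u : ℝ → ℝ} (hu : Differentiable ℝ u) :
    ∀ᵐ x, u x = 0 → deriv u x = 0 := by
  -- Zeros with nonzero derivative are isolated, so they form a discrete, hence countable, subset of
  -- the line.
  have hc : {x | u x = 0 ∧ deriv u x ≠ 0}.Countable := by
    have hd : IsDiscrete {x | u x = 0 ∧ deriv u x ≠ 0} := by
      refine IsDiscrete.of_nhdsWithin fun x hx => ?_
      rw [Filter.le_pure_iff, mem_nhdsWithin_iff_eventually]
      have h := (hu x).hasDerivAt.eventually_ne (c := 0) hx.2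
      rw [eventually_nhdsWithin_iff] at h
      filter_upwards [h] with y hy hyS
      by_contra hne
      exact hy hne hyS.1
    have := hd.to_subtype
    exact TopologicalSpace.separableSpace_iff_countable.1 inferInstance
  filter_upwards [hc.ae_notMem volume] with x hx h0
  by_contra h1
  exact hx ⟨h0, h1⟩

/-- Smooth truncations near the origin, with derivatives bounded uniformly in the scale. -/
theorem exists_truncation : ∃ K : ℝ, 0 ≤ K ∧ ∀ ε : ℝ, 0 < ε → ∃ T : ℝ → ℝ, ContDiff ℝ 1 T ∧
    (∀ t, |t| ≤ ε → T t = 0) ∧ (∀ t, 2 * ε ≤ |t| → T t = t) ∧ (∀ t, |T t| ≤ |t|) ∧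
    ∀ t, |deriv T t| ≤ K := by
  let b : ContDiffBump (0 : ℝ) := ⟨1, 2, one_pos, one_lt_two⟩
  have hb : ContDiff ℝ 1 (fun t => b t) := b.contDiff
  have hb0 : ∀ t : ℝ, |t| ≤ 1 → b t = 1 := fun t ht =>
    b.one_of_mem_closedBall (by simpa [b] using ht)
  have hb2 : ∀ t : ℝ, 2 ≤ |t| → b t = 0 := fun t ht =>
    b.zero_of_le_dist (by simpa [b] using ht)
  -- The truncation at scale `ε` is `t - ε τ(t/ε)`; its derivative `1 - τ'(t/ε)` has a bound
  -- independent of `ε`.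
  let τ : ℝ → ℝ := fun t => t * b t
  have hτ : ContDiff ℝ 1 τ := contDiff_id.mul hb
  have hτc : HasCompactSupport τ := b.hasCompactSupport.mul_left
  obtain ⟨K, hK⟩ := (hτ.continuous_deriv le_rfl).bounded_above_of_compact_support hτc.deriv
  refine ⟨1 + K, by linarith [(norm_nonneg _).trans (hK 0)], fun ε hε => ?_⟩
  have hder : ∀ t, HasDerivAt (fun t => t - ε * τ (t / ε)) (1 - deriv τ (t / ε)) t := by
    intro t
    have h1 := (hτ.differentiable one_ne_zero (t / ε)).hasDerivAt
    refine ((hasDerivAt_id t).sub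
      ((h1.comp t ((hasDerivAt_id t).div_const ε)).const_mul ε)).congr_deriv ?_
    field_simp
  refine ⟨fun t => t - ε * τ (t / ε), ?_, ?_, ?_, ?_, ?_⟩
  · exact contDiff_id.sub (contDiff_const.mul (hτ.comp (contDiff_id.div_const ε)))
  · intro t ht
    have : b (t / ε) = 1 := hb0 _ (by rw [abs_div, abs_of_pos hε]; exact (div_le_one hε).2 ht)
    simp only [τ, this]
    field_simp
    simp
  · intro t ht
    have : b (t / ε) = 0 := hb2 _ (by rw [abs_div, abs_of_pos hε]; exact (le_div_iff₀ hε).2 ht)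
    simp [τ, this]
  · intro t
    have h1 : t - ε * τ (t / ε) = t * (1 - b (t / ε)) := by
      simp only [τ]
      field_simp
    simp only
    rw [h1, abs_mul]
    have h2 : |1 - b (t / ε)| ≤ 1 := by
      rw [abs_le]
      constructor <;> linarith [b.nonneg' (t / ε), b.le_one (x := t / ε)]
    exact mul_le_of_le_one_right (abs_nonneg t) h2
  · intro t
    rw [(hder t).deriv]
    calc |1 - deriv τ (t / ε)| ≤ |1| + |deriv τ (t / ε)| := abs_sub _ _
      _ ≤ 1 + K := by
        rw [abs_one]
        exact add_le_add_right (hK _) 1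

/-- The potential of the Schrödinger form of `a D a⁻¹ ⋅ a⁻¹ D* ⋅`, where `E = a⁻²`. -/
noncomputable def potential (V a : ℝ → ℝ) (x : ℝ) : ℝ :=
  (deriv (deriv a) x + deriv V x * deriv a x + a x * deriv (deriv V) x) / a x

/-- In terms of `a = E^{1/2}` the nonlinear term of `calA` cancels against part of `2 E''`. Applied
to `a = E_k^{-1/2}`, it gives `1 / a² + potential V a = E_k (1 + 𝒜(E_k⁻¹)) = E_{k+1}`. -/
theorem calA_sq {V a : ℝ → ℝ} (ha : ContDiff ℝ 2 a) (ha0 : ∀ x, 0 < a x) (x : ℝ) :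
    calA V (fun y => a y ^ 2) x = a x ^ 2 * potential V a x := by
  have h1 : ∀ x, HasDerivAt a (deriv a x) x := fun x =>
    (ha.differentiable two_ne_zero x).hasDerivAt
  have ha' : ContDiff ℝ 1 (deriv a) := (contDiff_succ_iff_deriv (n := 1).1 ha).2.2
  have h2 : ∀ x, HasDerivAt (deriv a) (deriv (deriv a) x) x := fun x =>
    (ha'.differentiable one_ne_zero x).hasDerivAt
  have d1 : deriv (fun y => a y ^ 2) = fun y => 2 * a y * deriv a y := by
    funext y
    simpa using ((h1 y).fun_pow 2).deriv
  have d2 : deriv (fun y => 2 * a y * deriv a y) x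
      = 2 * deriv a x * deriv a x + 2 * a x * deriv (deriv a) x :=
    (((h1 x).const_mul 2).mul (h2 x)).deriv
  have := (ha0 x).ne'
  rw [calA, potential, d1, d2]
  field_simp
  ring

section Truncation

variable {V a u : ℝ → ℝ} [IsProbabilityMeasure (gibbs V)]

/-- The integrated form of `a D* a⁻¹ ⋅ a⁻¹ D a = D* D + potential`. -/
theorem integral_sq_deriv_add_potential (hV : ContDiff ℝ 2 V) (ha : ContDiff ℝ 2 a)
    (ha0 : ∀ x, 0 < a x) {φ : ℝ → ℝ} (hφ : ContDiff ℝ 1 φ) (hc : HasCompactSupport φ) :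
    ∫ x, (deriv φ x ^ 2 + potential V a x * φ x ^ 2) ∂gibbs V =
      ∫ x, ((deriv a x / a x + deriv V x) * φ x - deriv φ x) ^ 2 ∂gibbs V := by
  have ha' : ContDiff ℝ 1 (deriv a) := (contDiff_succ_iff_deriv (n := 1).1 ha).2.2
  have hV' : ContDiff ℝ 1 (deriv V) := (contDiff_succ_iff_deriv (n := 1).1 hV).2.2
  have hane : ∀ x, a x ≠ 0 := fun x => (ha0 x).ne'
  have hb : ContDiff ℝ 1 (fun x => deriv a x / a x + deriv V x) :=
    (ha'.div (ha.of_le one_le_two) hane).add hV'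
  -- The two integrands differ by exactly `D*` of this function, which has zero mean.
  have hΦ : ContDiff ℝ 1 (fun x => (deriv a x / a x + deriv V x) * φ x ^ 2) := hb.mul (hφ.pow 2)
  have hc2 : HasCompactSupport (fun x => φ x ^ 2) := hc.comp_left (g := fun t => t ^ 2) (by simp)
  have h := integral_dstar_eq_zero (hV.of_le one_le_two) hΦ hc2.mul_left
  have c1 := ha'.continuous
  have c2 := hV'.continuous
  have c3 := ha'.continuous_deriv le_rfl
  have c4 := hV'.continuous_deriv le_rfl
  have c5 := ha.continuous
  have c6 := hφ.continuous
  have c7 := hφ.continuous_deriv le_rfl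
  have cp : Continuous (potential V a) := by
    unfold potential
    exact Continuous.div (by fun_prop) c5 hane
  have c8 := hb.continuous
  symm
  rw [← sub_eq_zero, ← integral_sub, ← h]
  · refine integral_congr_ae (Eventually.of_forall fun x => ?_)
    have h1 := (ha.differentiable two_ne_zero x).hasDerivAt
    have h2 := (ha'.differentiable one_ne_zero x).hasDerivAt
    have h3 := (hV'.differentiable one_ne_zero x).hasDerivAt
    have h4 := (hφ.differentiable one_ne_zero x).hasDerivAt
    have h5 : deriv (fun x => (deriv a x / a x + deriv V x) * φ x ^ 2) x = _ :=
      (((h2.div h1 (hane x)).add h3).mul (h4.pow 2)).deriv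
    simp only [h5, potential, Pi.add_apply, Pi.div_apply, Pi.pow_apply]
    have := hane x
    field_simp
    ring
  · refine integrable_gibbs_of_hasCompactSupport (by fun_prop) ?_
    exact (hc.mul_left.sub hc.deriv).comp_left (g := fun t => t ^ 2) (by simp)
  · refine integrable_gibbs_of_hasCompactSupport (by fun_prop) ?_
    exact (hc.deriv.comp_left (g := fun t => t ^ 2) (by simp)).add hc2.mul_left

/-- If the flux `u e^{-V}` vanishes at infinity and `a D* u` is square integrable, then `a u` has
finite energy. -/
theorem integrable_energy_of_flux (hV : ContDiff ℝ 2 V) (ha : ContDiff ℝ 2 a)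
    (ha0 : ∀ x, 0 < a x) (hu : ContDiff ℝ 1 u) {c : ℝ} (hc : 0 ≤ c)
    (hF : ∀ x, 0 ≤ c / a x ^ 2 + potential V a x)
    (hs : Tendsto (fun x => Real.exp (-V x) * u x) (cocompact ℝ) (nhds 0))
    (h1 : Integrable (fun x => c * u x ^ 2) (gibbs V))
    (h2 : Integrable (fun x => (a x * (deriv V x * u x - deriv u x)) ^ 2) (gibbs V)) :
    Integrable (fun x => deriv (fun x => a x * u x) x ^ 2 +
      (c / a x ^ 2 + potential V a x) * (a x * u x) ^ 2) (gibbs V) := by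
  have hane : ∀ x, a x ≠ 0 := fun x => (ha0 x).ne'
  have ha' : ContDiff ℝ 1 (deriv a) := (contDiff_succ_iff_deriv (n := 1).1 ha).2.2
  have hV' : ContDiff ℝ 1 (deriv V) := (contDiff_succ_iff_deriv (n := 1).1 hV).2.2
  have ha1 : ContDiff ℝ 1 a := ha.of_le one_le_two
  have hV1 : ContDiff ℝ 1 V := hV.of_le one_le_two
  have c1 := ha'.continuous
  have c2 := hV'.continuous
  have c3 := ha'.continuous_deriv le_rfl
  have c4 := hV'.continuous_deriv le_rfl
  have c5 := ha.continuous
  have cp : Continuous (potential V a) := by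
    unfold potential
    exact Continuous.div (by fun_prop) c5 hane
  have cF : Continuous fun x => c / a x ^ 2 + potential V a x :=
    (continuous_const.div (c5.pow 2) fun x => pow_ne_zero 2 (hane x)).add cp
  have hq : ContDiff ℝ 1 (fun x => a x * u x) := ha1.mul hu
  set s : ℝ → ℝ := fun x => Real.exp (-V x) * u x with hsdef
  have hs1 : ContDiff ℝ 1 s := (hV1.neg.exp).mul hu
  have hus : ∀ x, u x = Real.exp (V x) * s x := by
    intro x
    rw [hsdef]
    simp only
    rw [← mul_assoc, ← Real.exp_add]
    simp
  have hs' : ∀ x, HasDerivAt s (-(Real.exp (-V x) * (deriv V x * u x - deriv u x))) x := by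
    intro x
    refine (((hV1.differentiable one_ne_zero x).hasDerivAt.neg.exp).mul
      (hu.differentiable one_ne_zero x).hasDerivAt).congr_deriv ?_
    simp only [Pi.neg_apply]
    ring
  obtain ⟨K, hK0, hK⟩ := exists_truncation
  choose T hT1 hTz hTi hTle hTd using fun j : ℕ => hK (1 / ((j : ℝ) + 1)) Nat.one_div_pos_of_nat
  -- The cutoff acts on the value of the flux, not on position. Since `s → 0` at infinity, `φ j` has
  -- compact support, and `a D*(a⁻¹ φ j) = T'(s) a D* u`: no error term arises, only the factor
  -- bounded by `K`.
  let φ : ℕ → ℝ → ℝ := fun j x => a x * (Real.exp (V x) * T j (s x))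
  have hφ : ∀ j, ContDiff ℝ 1 (φ j) := fun j =>
    ha1.mul ((hV1.exp).mul ((hT1 j).comp hs1))
  have hφc : ∀ j, HasCompactSupport (φ j) := by
    intro j
    have h := hs (Metric.closedBall_mem_nhds (0 : ℝ) (ε := 1 / ((j : ℝ) + 1))
      Nat.one_div_pos_of_nat)
    rw [mem_map, mem_cocompact] at h
    obtain ⟨t, ht, hsub⟩ := h
    refine HasCompactSupport.intro ht fun x hx => ?_
    have h3 := hsub hx
    have h4 : T j (s x) = 0 := hTz j _ (by simpa using h3)
    simp only [φ, h4, mul_zero]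
  let F : ℝ → ℝ := fun x => c / a x ^ 2 + potential V a x
  let G : ℕ → ℝ → ℝ := fun j x => deriv (φ j) x ^ 2 + F x * φ j x ^ 2
  let M : ℝ := K ^ 2 * ∫ x, (a x * (deriv V x * u x - deriv u x)) ^ 2 ∂gibbs V +
    ∫ x, c * u x ^ 2 ∂gibbs V
  have hGc : ∀ j, Continuous (G j) := fun j => by
    have h3 := (hφ j).continuous
    have h4 := (hφ j).continuous_deriv le_rfl
    exact (h4.pow 2).add (cF.mul (h3.pow 2))
  have hG0 : ∀ j x, 0 ≤ G j x := fun j x =>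
    add_nonneg (sq_nonneg _) (mul_nonneg (hF x) (sq_nonneg _))
  have hφ2 : ∀ j, HasCompactSupport (fun x => φ j x ^ 2) := fun j =>
    (hφc j).comp_left (g := fun t => t ^ 2) (by simp)
  have hGi : ∀ j, Integrable (G j) (gibbs V) := fun j =>
    integrable_gibbs_of_hasCompactSupport (hGc j)
      (((hφc j).deriv.comp_left (g := fun t => t ^ 2) (by simp)).add (hφ2 j).mul_left)
  have hGM : ∀ j, ∫ x, G j x ∂gibbs V ≤ M := by
    intro j
    have h3 := (hφ j).continuous
    have h4 := (hφ j).continuous_deriv le_rfl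
    have i1 : Integrable (fun x => deriv (φ j) x ^ 2 + potential V a x * φ j x ^ 2) (gibbs V) :=
      integrable_gibbs_of_hasCompactSupport ((h4.pow 2).add (cp.mul (h3.pow 2)))
        (((hφc j).deriv.comp_left (g := fun t => t ^ 2) (by simp)).add (hφ2 j).mul_left)
    have i2 : Integrable (fun x => c / a x ^ 2 * φ j x ^ 2) (gibbs V) :=
      integrable_gibbs_of_hasCompactSupport
        ((continuous_const.div (c5.pow 2) fun x => pow_ne_zero 2 (hane x)).mul (h3.pow 2))
        (hφ2 j).mul_left
    have e1 : ∫ x, G j x ∂gibbs V =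
        ∫ x, (deriv (φ j) x ^ 2 + potential V a x * φ j x ^ 2) ∂gibbs V +
        ∫ x, c / a x ^ 2 * φ j x ^ 2 ∂gibbs V := by
      rw [← integral_add i1 i2]
      refine integral_congr_ae (Eventually.of_forall fun x => ?_)
      simp only [G, F]
      ring
    rw [e1, integral_sq_deriv_add_potential hV ha ha0 (hφ j) (hφc j)]
    refine add_le_add ?_ ?_
    · rw [← integral_const_mul]
      refine integral_mono_of_nonneg (Eventually.of_forall fun x => sq_nonneg _)
        (h2.const_mul _) (Eventually.of_forall fun x => ?_)
      have d1 := (ha1.differentiable one_ne_zero x).hasDerivAt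
      have d2 := (hV1.differentiable one_ne_zero x).hasDerivAt
      have d3 := ((hT1 j).differentiable one_ne_zero (s x)).hasDerivAt
      have d4 : deriv (φ j) x = _ := (d1.mul (d2.exp.mul (d3.comp x (hs' x)))).deriv
      have e2 : (deriv a x / a x + deriv V x) * φ j x - deriv (φ j) x =
          deriv (T j) (s x) * (a x * (deriv V x * u x - deriv u x)) := by
        have e3 : Real.exp (V x) * Real.exp (-V x) = 1 := by rw [← Real.exp_add]; simp
        rw [d4]
        simp only [φ, Function.comp_apply, Pi.mul_apply]
        have := hane x
        field_simp
        linear_combination (deriv (T j) (s x) * (deriv V x * u x - deriv u x) * a x) * e3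
      simp only
      rw [e2, mul_pow]
      refine mul_le_mul_of_nonneg_right ?_ (sq_nonneg _)
      exact sq_le_sq' (abs_le.1 (hTd j (s x))).1 (abs_le.1 (hTd j (s x))).2
    · refine integral_mono_of_nonneg (Eventually.of_forall fun x => by positivity)
        h1 (Eventually.of_forall fun x => ?_)
      have e2 : c / a x ^ 2 * φ j x ^ 2 = c * (Real.exp (V x) * T j (s x)) ^ 2 := by
        simp only [φ]
        have := hane x
        field_simp
      simp only
      rw [e2, hus x, mul_pow, mul_pow]
      have := sq_le_sq.2 (hTle j (s x))
      gcongr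
  -- Input for Fatou's lemma. Where `u x ≠ 0`, `φ j` agrees with `a u` near `x` for large `j`; where
  -- `u x = 0`, almost everywhere also `u' x = 0`, so the energy density of `a u` vanishes.
  have hae : ∀ᵐ x ∂gibbs V, ENNReal.ofReal (deriv (fun x => a x * u x) x ^ 2 +
      F x * (a x * u x) ^ 2) ≤ liminf (fun j => ENNReal.ofReal (G j x)) atTop := by
    filter_upwards [gibbs_absolutelyContinuous (ae_deriv_eq_zero_of_eq_zero
      (hu.differentiable one_ne_zero))] with x hx
    by_cases h0 : u x = 0
    · have d1 := (ha1.differentiable one_ne_zero x).hasDerivAt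
      have d2 := (hu.differentiable one_ne_zero x).hasDerivAt
      have d3 : deriv (fun x => a x * u x) x = _ := (d1.mul d2).deriv
      rw [d3, h0, hx h0]
      simp
    · have hsx : 0 < |s x| := abs_pos.2 (mul_ne_zero (Real.exp_ne_zero _) h0)
      have hlim : Tendsto (fun j : ℕ => 2 * (1 / ((j : ℝ) + 1))) atTop (nhds 0) := by
        simpa using tendsto_one_div_add_atTop_nhds_zero_nat.const_mul (2 : ℝ)
      have hev : ∀ᶠ j : ℕ in atTop, ENNReal.ofReal (deriv (fun x => a x * u x) x ^ 2 +
          F x * (a x * u x) ^ 2) = ENNReal.ofReal (G j x) := by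
        filter_upwards [hlim.eventually (gt_mem_nhds hsx)] with j hj
        have hn : φ j =ᶠ[nhds x] fun x => a x * u x := by
          filter_upwards [hs1.continuous.abs.continuousAt.eventually (lt_mem_nhds hj)] with y hy
          simp only [φ]
          rw [hTi j _ hy.le, hus y]
        simp only [G]
        rw [hn.deriv_eq, hn.eq_of_nhds]
      exact (tendsto_const_nhds.congr' hev).liminf_eq.ge
  have cG : Continuous fun x => deriv (fun x => a x * u x) x ^ 2 + F x * (a x * u x) ^ 2 := by
    have h3 := hq.continuous
    have h4 := hq.continuous_deriv le_rfl
    exact (h4.pow 2).add (cF.mul (h3.pow 2))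
  refine (lintegral_ofReal_ne_top_iff_integrable cG.aestronglyMeasurable
    (Eventually.of_forall fun x =>
      add_nonneg (sq_nonneg _) (mul_nonneg (hF x) (sq_nonneg _)))).1 (ne_of_lt ?_)
  calc _ ≤ ∫⁻ x, liminf (fun j => ENNReal.ofReal (G j x)) atTop ∂gibbs V := lintegral_mono_ae hae
    _ ≤ liminf (fun j => ∫⁻ x, ENNReal.ofReal (G j x) ∂gibbs V) atTop :=
      lintegral_liminf_le fun j => (hGc j).measurable.ennreal_ofReal
    _ ≤ ENNReal.ofReal M := by
      refine liminf_le_of_frequently_le' (Frequently.of_forall fun j => ?_)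
      rw [← ofReal_integral_eq_lintegral_ofReal (hGi j) (Eventually.of_forall (hG0 j))]
      exact ENNReal.ofReal_le_ofReal (hGM j)
    _ < ⊤ := ENNReal.ofReal_lt_top

end Truncation

/-! ### The adjoint and the closure of `S`. -/

section Graph

variable {V E : ℝ → ℝ}

theorem inner_L2_eq (f g : L2 V) : inner ℝ f g = ∫ x, f x * g x ∂gibbs V := by
  rw [L2.inner_def]
  refine integral_congr_ae (Eventually.of_forall fun x => ?_)
  simp [mul_comm]

/-- A continuously differentiable `u` with `u` and `E^{-1/2} D* u` in `L²(μ)` is in the domain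
of `S*`. -/
theorem mem_graphS_adjoint [IsFiniteMeasure (gibbs V)] (hV : ContDiff ℝ 1 V) {u : ℝ → ℝ}
    (hu : ContDiff ℝ 1 u) {U W : L2 V} (hU : U =ᵐ[gibbs V] u)
    (hW : (fun x => Real.sqrt (E x) * W x) =ᵐ[gibbs V] fun x => deriv V x * u x - deriv u x) :
    (U, W) ∈ (graphS V E).adjoint := by
  rw [Submodule.mem_adjoint_iff]
  rintro A B ⟨ζ, h1, h2, h3, h4⟩
  simp only at h3 h4 ⊢
  rw [inner_L2_eq, inner_L2_eq, sub_eq_zero]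
  calc ∫ x, B x * U x ∂gibbs V = ∫ x, deriv ζ x * u x ∂gibbs V := by
        refine integral_congr_ae ?_
        filter_upwards [h4, hU] with x hx hx'
        rw [hx, hx']
    _ = ∫ x, ζ x * (deriv V x * u x - deriv u x) ∂gibbs V := integral_deriv_mul_gibbs hV h1 hu h2
    _ = ∫ x, A x * W x ∂gibbs V := by
        refine integral_congr_ae ?_
        filter_upwards [h3, hW] with x hx hx'
        rw [hx, ← hx']
        ring

variable [IsProbabilityMeasure (gibbs V)]

theorem integral_eq_of_mem_graphS_adjoint (hE : Continuous E) {A B : L2 V}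
    (hAB : (A, B) ∈ (graphS V E).adjoint) {ζ : ℝ → ℝ} (h1 : ContDiff ℝ 1 ζ)
    (h2 : HasCompactSupport ζ) :
    ∫ x, deriv ζ x * A x ∂gibbs V = ∫ x, Real.sqrt (E x) * ζ x * B x ∂gibbs V := by
  have m1 : MemLp (fun x => Real.sqrt (E x) * ζ x) 2 (gibbs V) :=
    (hE.sqrt.mul h1.continuous).memLp_of_hasCompactSupport h2.mul_left
  have m2 : MemLp (deriv ζ) 2 (gibbs V) :=
    (h1.continuous_deriv le_rfl).memLp_of_hasCompactSupport h2.deriv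
  have h := (Submodule.mem_adjoint_iff _ _).1 hAB m1.toLp m2.toLp
    ⟨ζ, h1, h2, m1.coeFn_toLp, m2.coeFn_toLp⟩
  simp only at h
  rw [inner_L2_eq, inner_L2_eq, sub_eq_zero] at h
  convert h using 1
  · refine integral_congr_ae ?_
    filter_upwards [m2.coeFn_toLp] with x hx
    rw [hx]
  · refine integral_congr_ae ?_
    filter_upwards [m1.coeFn_toLp] with x hx
    rw [hx]

/-- Spatial cutoffs `χ(h_j x)` suffice when `y` is bounded: the term in which the derivative hits
the cutoff is dominated by `K N |A|`, integrable because `μ` is finite, and it tends to zero with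
`h_j`. -/
theorem integral_eq_of_mem_graphS_adjoint_of_bounded (hE : Continuous E) {A B : L2 V}
    (hAB : (A, B) ∈ (graphS V E).adjoint) {y : ℝ → ℝ} (hy : ContDiff ℝ 1 y) {N : ℝ}
    (hN : ∀ x, |y x| ≤ N) (m1 : MemLp (fun x => Real.sqrt (E x) * y x) 2 (gibbs V))
    (m2 : MemLp (deriv y) 2 (gibbs V)) :
    ∫ x, deriv y x * A x ∂gibbs V = ∫ x, Real.sqrt (E x) * y x * B x ∂gibbs V := by
  let χ : ContDiffBump (0 : ℝ) := ⟨1, 2, one_pos, one_lt_two⟩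
  have hχ : ContDiff ℝ 1 (fun t => χ t) := χ.contDiff
  have hχc : HasCompactSupport (fun t => χ t) := χ.hasCompactSupport
  have hχ0 : χ (0 : ℝ) = 1 := χ.one_of_mem_closedBall (by simp [χ])
  obtain ⟨K, hK⟩ := (hχ.continuous_deriv le_rfl).bounded_above_of_compact_support hχc.deriv
  have hK0 : 0 ≤ K := (norm_nonneg _).trans (hK 0)
  have hN0 : 0 ≤ N := (abs_nonneg _).trans (hN 0)
  let h : ℕ → ℝ := fun j => 1 / ((j : ℝ) + 1)
  have hh0 : ∀ j, 0 < h j := fun j => Nat.one_div_pos_of_nat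
  have hh1 : ∀ j, h j ≤ 1 := fun j => by
    simp only [h]
    rw [div_le_one (by positivity)]
    linarith [(Nat.cast_nonneg j : (0 : ℝ) ≤ j)]
  have hlim : Tendsto h atTop (nhds 0) := tendsto_one_div_add_atTop_nhds_zero_nat
  let ζ : ℕ → ℝ → ℝ := fun j x => χ (h j * x) * y x
  have hζ : ∀ j, ContDiff ℝ 1 (ζ j) := fun j =>
    (hχ.comp (contDiff_const.mul contDiff_id)).mul hy
  have hζc : ∀ j, HasCompactSupport (ζ j) := fun j =>
    (hχc.comp_homeomorph (Homeomorph.mulLeft₀ (h j) (hh0 j).ne')).mul_right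
  have hd : ∀ j x, deriv (ζ j) x =
      h j * deriv (fun t => χ t) (h j * x) * y x + χ (h j * x) * deriv y x := by
    intro j x
    have d1 := (hχ.differentiable one_ne_zero (h j * x)).hasDerivAt
    have d2 := (hy.differentiable one_ne_zero x).hasDerivAt
    have d3 : HasDerivAt (fun x => h j * x) (h j) x := by
      simpa using (hasDerivAt_id x).const_mul (h j)
    have := ((d1.comp x d3).mul d2).deriv
    simp only [ζ]
    rw [mul_comm (h j) (deriv _ _)]
    exact this
  have hlx : ∀ x : ℝ, Tendsto (fun j => χ (h j * x)) atTop (nhds 1) := by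
    intro x
    have h1 : Tendsto (fun j => h j * x) atTop (nhds 0) := by simpa using hlim.mul_const x
    have := (hχ.continuous.tendsto 0).comp h1
    rwa [hχ0] at this
  have mA : MemLp A 2 (gibbs V) := Lp.memLp A
  have mB : MemLp B 2 (gibbs V) := Lp.memLp B
  have t1 : Tendsto (fun j => ∫ x, deriv (ζ j) x * A x ∂gibbs V) atTop
      (nhds (∫ x, deriv y x * A x ∂gibbs V)) := by
    refine tendsto_integral_of_dominated_convergence
      (fun x => K * N * |A x| + |deriv y x * A x|) (fun j => ?_) ?_ (fun j => ?_) ?_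
    · exact ((hζ j).continuous_deriv le_rfl).aestronglyMeasurable.mul mA.1
    · exact ((mA.integrable one_le_two).abs.const_mul _).add (m2.integrable_mul mA).abs
    · refine Eventually.of_forall fun x => ?_
      rw [hd, Real.norm_eq_abs, add_mul]
      refine (abs_add_le _ _).trans (add_le_add ?_ ?_)
      · rw [abs_mul, abs_mul, abs_mul, abs_of_pos (hh0 j)]
        have h1 := hK (h j * x)
        rw [Real.norm_eq_abs] at h1
        have h2 : h j * |deriv (fun t => χ t) (h j * x)| ≤ K := by
          calc h j * |deriv (fun t => χ t) (h j * x)| ≤ 1 * K :=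
                mul_le_mul (hh1 j) h1 (abs_nonneg _) zero_le_one
            _ = K := one_mul K
        exact mul_le_mul_of_nonneg_right (mul_le_mul h2 (hN x) (abs_nonneg _) hK0) (abs_nonneg _)
      · rw [mul_assoc, abs_mul, abs_of_nonneg (χ.nonneg' _)]
        exact mul_le_of_le_one_left (abs_nonneg _) χ.le_one
    · refine Eventually.of_forall fun x => ?_
      refine Tendsto.mul_const _ ?_
      simp only [hd]
      have b1 : Tendsto (fun j => h j * deriv (fun t => χ t) (h j * x)) atTop (nhds 0) := by
        refine squeeze_zero_norm (a := fun j => h j * K) (fun j => ?_)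
          (by simpa using hlim.mul_const K)
        rw [norm_mul, Real.norm_of_nonneg (hh0 j).le]
        exact mul_le_mul_of_nonneg_left (hK _) (hh0 j).le
      simpa using (b1.mul_const (y x)).add ((hlx x).mul_const (deriv y x))
  have t2 : Tendsto (fun j => ∫ x, Real.sqrt (E x) * ζ j x * B x ∂gibbs V) atTop
      (nhds (∫ x, Real.sqrt (E x) * y x * B x ∂gibbs V)) := by
    refine tendsto_integral_of_dominated_convergence
      (fun x => |Real.sqrt (E x) * y x * B x|) (fun j => ?_) ?_ (fun j => ?_) ?_
    · exact (hE.sqrt.mul (hζ j).continuous).aestronglyMeasurable.mul mB.1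
    · exact (m1.integrable_mul mB).abs
    · refine Eventually.of_forall fun x => ?_
      have : Real.sqrt (E x) * ζ j x * B x = χ (h j * x) * (Real.sqrt (E x) * y x * B x) := by
        simp only [ζ]; ring
      rw [this, Real.norm_eq_abs, abs_mul, abs_of_nonneg (χ.nonneg' _)]
      exact mul_le_of_le_one_left (abs_nonneg _) χ.le_one
    · refine Eventually.of_forall fun x => ?_
      refine Tendsto.mul_const _ (Tendsto.const_mul _ ?_)
      simpa using (hlx x).mul_const (y x)
  refine tendsto_nhds_unique t1 (t2.congr fun j => ?_)
  exact (integral_eq_of_mem_graphS_adjoint hE hAB (hζ j) (hζc j)).symm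

/-- Functions of finite energy are in the domain of the closure of `S`. -/
theorem mem_graphS_adjoint_adjoint (hE : Continuous E) {y : ℝ → ℝ} (hy : ContDiff ℝ 1 y)
    {P Q : L2 V} (hP : P =ᵐ[gibbs V] fun x => Real.sqrt (E x) * y x)
    (hQ : Q =ᵐ[gibbs V] deriv y) : (P, Q) ∈ (graphS V E).adjoint.adjoint := by
  have m1 : MemLp (fun x => Real.sqrt (E x) * y x) 2 (gibbs V) := (Lp.memLp P).ae_eq hP
  have m2 : MemLp (deriv y) 2 (gibbs V) := (Lp.memLp Q).ae_eq hQ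
  rw [Submodule.mem_adjoint_iff]
  intro A B hAB
  have mA : MemLp A 2 (gibbs V) := Lp.memLp A
  have mB : MemLp B 2 (gibbs V) := Lp.memLp B
  simp only
  rw [inner_L2_eq, inner_L2_eq, sub_eq_zero]
  let h : ℕ → ℝ := fun j => 1 / ((j : ℝ) + 1)
  have hh0 : ∀ j, 0 < h j := fun j => Nat.one_div_pos_of_nat
  have hlim : Tendsto h atTop (nhds 0) := tendsto_one_div_add_atTop_nhds_zero_nat
  -- A smooth bounded approximation: `|z_j| ≤ |y|` and `|z_j'| ≤ |y'|`, with pointwise convergence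
  -- to `y` and `y'`, so dominated convergence removes the boundedness assumption.
  let z : ℕ → ℝ → ℝ := fun j x => (h j)⁻¹ * Real.sin (h j * y x)
  have hz : ∀ j, ContDiff ℝ 1 (z j) := fun j =>
    contDiff_const.mul (Real.contDiff_sin.comp (contDiff_const.mul hy))
  have hd : ∀ j x, deriv (z j) x = Real.cos (h j * y x) * deriv y x := by
    intro j x
    have d2 := (hy.differentiable one_ne_zero x).hasDerivAt
    have d3 : deriv (z j) x = _ := (((d2.const_mul (h j)).sin).const_mul (h j)⁻¹).deriv
    rw [d3]
    have := (hh0 j).ne'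
    field_simp
  have hzb : ∀ j x, |z j x| ≤ (h j)⁻¹ := by
    intro j x
    rw [abs_mul, abs_of_pos (inv_pos.2 (hh0 j))]
    exact mul_le_of_le_one_right (inv_pos.2 (hh0 j)).le (Real.abs_sin_le_one _)
  have hzy : ∀ j x, |z j x| ≤ |y x| := by
    intro j x
    rw [abs_mul, abs_of_pos (inv_pos.2 (hh0 j)), inv_mul_le_iff₀ (hh0 j)]
    refine (Real.abs_sin_le_abs).trans ?_
    rw [abs_mul, abs_of_pos (hh0 j)]
  have hb1 : ∀ j x, |Real.sqrt (E x) * z j x| ≤ |Real.sqrt (E x) * y x| := by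
    intro j x
    rw [abs_mul _ (z j x), abs_mul _ (y x)]
    exact mul_le_mul_of_nonneg_left (hzy j x) (abs_nonneg _)
  have hb2 : ∀ j x, |deriv (z j) x| ≤ |deriv y x| := by
    intro j x
    rw [hd, abs_mul]
    exact mul_le_of_le_one_left (abs_nonneg _) (Real.abs_cos_le_one _)
  have n1 : ∀ j, MemLp (fun x => Real.sqrt (E x) * z j x) 2 (gibbs V) := fun j =>
    m1.of_le (hE.sqrt.mul (hz j).continuous).aestronglyMeasurable (Eventually.of_forall (hb1 j))
  have n2 : ∀ j, MemLp (deriv (z j)) 2 (gibbs V) := fun j =>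
    m2.of_le ((hz j).continuous_deriv le_rfl).aestronglyMeasurable (Eventually.of_forall (hb2 j))
  have hhy : ∀ x, Tendsto (fun j => h j * y x) atTop (nhds 0) := fun x => by
    simpa using hlim.mul_const (y x)
  have t1 : Tendsto (fun j => ∫ x, deriv (z j) x * A x ∂gibbs V) atTop
      (nhds (∫ x, deriv y x * A x ∂gibbs V)) := by
    refine tendsto_integral_of_dominated_convergence
      (fun x => |deriv y x * A x|) (fun j => (n2 j).1.mul mA.1) (m2.integrable_mul mA).abs
      (fun j => Eventually.of_forall fun x => ?_) (Eventually.of_forall fun x => ?_)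
    · rw [Real.norm_eq_abs, abs_mul, abs_mul]
      exact mul_le_mul_of_nonneg_right (hb2 j x) (abs_nonneg _)
    · refine Tendsto.mul_const _ ?_
      simp only [hd]
      have := ((Real.continuous_cos.tendsto 0).comp (hhy x)).mul_const (deriv y x)
      simpa [Function.comp_def] using this
  have t2 : Tendsto (fun j => ∫ x, Real.sqrt (E x) * z j x * B x ∂gibbs V) atTop
      (nhds (∫ x, Real.sqrt (E x) * y x * B x ∂gibbs V)) := by
    refine tendsto_integral_of_dominated_convergence
      (fun x => |Real.sqrt (E x) * y x * B x|) (fun j => (n1 j).1.mul mB.1)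
      (m1.integrable_mul mB).abs
      (fun j => Eventually.of_forall fun x => ?_) (Eventually.of_forall fun x => ?_)
    · rw [Real.norm_eq_abs, abs_mul, abs_mul (_ * _)]
      exact mul_le_mul_of_nonneg_right (hb1 j x) (abs_nonneg _)
    · refine Tendsto.mul_const _ (Tendsto.const_mul _ ?_)
      have d1 : HasDerivAt (fun t => Real.sin (t * y x)) (y x) 0 := by
        simpa using ((hasDerivAt_id (0 : ℝ)).mul_const (y x)).sin
      have d2 := d1.tendsto_slope_zero
      have d3 : Tendsto h atTop (nhdsWithin 0 {0}ᶜ) :=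
        tendsto_nhdsWithin_iff.2 ⟨hlim, Eventually.of_forall fun j => (hh0 j).ne'⟩
      simpa [Function.comp_def, z] using d2.comp d3
  have key : ∀ j, ∫ x, deriv (z j) x * A x ∂gibbs V =
      ∫ x, Real.sqrt (E x) * z j x * B x ∂gibbs V := fun j =>
    integral_eq_of_mem_graphS_adjoint_of_bounded hE hAB (hz j) (hzb j) (n1 j) (n2 j)
  have := tendsto_nhds_unique t1 (t2.congr fun j => (key j).symm)
  calc ∫ x, B x * P x ∂gibbs V = ∫ x, Real.sqrt (E x) * y x * B x ∂gibbs V := by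
        refine integral_congr_ae ?_
        filter_upwards [hP] with x hx
        rw [hx, mul_comm]
    _ = ∫ x, deriv y x * A x ∂gibbs V := this.symm
    _ = ∫ x, A x * Q x ∂gibbs V := by
        refine integral_congr_ae ?_
        filter_upwards [hQ] with x hx
        rw [hx, mul_comm]

end Graph

/-! ### Regularity of the sequences `E_k` and `f_k`. -/

theorem contDiff_nat_deriv {m : ℕ} {g : ℝ → ℝ}
    (hg : ContDiff ℝ ((m + 1 : ℕ) : WithTop ℕ∞) g) :
    ContDiff ℝ (m : WithTop ℕ∞) (deriv g) := by
  push_cast at hg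
  exact (contDiff_succ_iff_deriv.1 hg).2.2

theorem contDiff_of_nat_le {m k : ℕ} {g : ℝ → ℝ} (hg : ContDiff ℝ (k : WithTop ℕ∞) g)
    (h : m ≤ k) : ContDiff ℝ (m : WithTop ℕ∞) g :=
  hg.of_le (by exact_mod_cast h)

theorem contDiff_inv_sqrt {m : WithTop ℕ∞} {E : ℝ → ℝ} (hE : ContDiff ℝ m E)
    (hE0 : ∀ x, 0 < E x) : ContDiff ℝ m fun x => (Real.sqrt (E x))⁻¹ :=
  (hE.sqrt fun x => (hE0 x).ne').inv fun x => (Real.sqrt_pos.2 (hE0 x)).ne'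

section Sequences

variable {n : ℕ} {V f : ℝ → ℝ}

/-- Each step of the recursion costs two derivatives through `calA`, so `E_k` is of class
`C^{2(n-k)+1}`. In particular `E_n` is `C¹`, which is what `D[E_n⁻¹ f_n]` requires. -/
theorem contDiff_seqE (hV : ContDiff ℝ ((2 * n + 1 : ℕ) : WithTop ℕ∞) V)
    (hE : ∀ k ∈ Finset.Icc 1 n, ∀ x : ℝ, 0 < seqE V k x) (j : ℕ) (hj : j + 1 ≤ n) :
    ContDiff ℝ ((2 * (n - (j + 1)) + 1 : ℕ) : WithTop ℕ∞) (seqE V (j + 1)) := by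
  have hV1 : ContDiff ℝ ((2 * n : ℕ) : WithTop ℕ∞) (deriv V) := contDiff_nat_deriv hV
  have hV2 : ContDiff ℝ ((2 * (n - 1) + 1 : ℕ) : WithTop ℕ∞) (deriv (deriv V)) :=
    contDiff_nat_deriv (contDiff_of_nat_le hV1 (by omega))
  induction j with
  | zero => exact hV2
  | succ j ih =>
    have h := ih (by omega)
    have hpos : ∀ x, 0 < seqE V (j + 1) x := hE _ (Finset.mem_Icc.2 ⟨by omega, by omega⟩)
    obtain ⟨m, hm⟩ : ∃ m, n - (j + 1) = m + 1 := ⟨n - (j + 1) - 1, by omega⟩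
    have hm' : n - (j + 1 + 1) = m := by omega
    rw [hm] at h
    rw [hm']
    have hB : ContDiff ℝ ((2 * m + 1 + 1 + 1 : ℕ) : WithTop ℕ∞) (fun y => (seqE V (j + 1) y)⁻¹) :=
      contDiff_of_nat_le (h.inv fun x => (hpos x).ne') (by omega)
    have hB1 := contDiff_nat_deriv hB
    have hB2 := contDiff_nat_deriv hB1
    have hA : ContDiff ℝ ((2 * m + 1 : ℕ) : WithTop ℕ∞)
        (calA V (fun y => (seqE V (j + 1) y)⁻¹)) := by
      unfold calA
      refine contDiff_const.mul ((((contDiff_const.mul hB2).add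
        ((contDiff_const.mul (contDiff_of_nat_le hV1 (by omega))).mul
          (contDiff_of_nat_le hB1 (by omega)))).sub
        (((contDiff_of_nat_le hB1 (by omega)).pow 2).div (contDiff_of_nat_le hB (by omega))
          fun x => inv_ne_zero (hpos x).ne')).add
        ((contDiff_const.mul (contDiff_of_nat_le hB (by omega))).mul
          (contDiff_of_nat_le hV2 (by omega))))
    exact (contDiff_of_nat_le h (by omega)).mul (contDiff_const.add hA)

/-- Here only one derivative is lost per step, leaving `f_n` of class `C¹`. -/
theorem contDiff_seqF (hV : ContDiff ℝ ((2 * n + 1 : ℕ) : WithTop ℕ∞) V)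
    (hE : ∀ k ∈ Finset.Icc 1 n, ∀ x : ℝ, 0 < seqE V k x)
    (hf : ContDiff ℝ ((n + 1 : ℕ) : WithTop ℕ∞) f) (j : ℕ) (hj : j + 1 ≤ n) :
    ContDiff ℝ ((n - (j + 1) + 1 : ℕ) : WithTop ℕ∞) (seqF V f (j + 1)) := by
  induction j with
  | zero => exact contDiff_of_nat_le (contDiff_nat_deriv hf) (by omega)
  | succ j ih =>
    have h := ih (by omega)
    have h2 := contDiff_seqE hV hE j (by omega)
    have hpos : ∀ x, 0 < seqE V (j + 1) x := hE _ (Finset.mem_Icc.2 ⟨by omega, by omega⟩)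
    have h3 : ContDiff ℝ ((n - (j + 1 + 1) + 1 : ℕ) : WithTop ℕ∞)
        (deriv fun y => (seqE V (j + 1) y)⁻¹ * seqF V f (j + 1) y) :=
      contDiff_nat_deriv (((contDiff_of_nat_le h2 (by omega)).inv fun x => (hpos x).ne').mul
        (contDiff_of_nat_le h (by omega)))
    exact ((contDiff_of_nat_le h2 (by omega)).sqrt fun x => (hpos x).ne').mul h3

theorem hasCompactSupport_seqF (hf : HasCompactSupport f) (k : ℕ) :
    HasCompactSupport (seqF V f k) := by
  induction k with
  | zero => exact hf
  | succ k ih =>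
    cases k with
    | zero => exact hf.deriv
    | succ k => exact (ih.mul_left).deriv.mul_left

theorem altSum_succ (j : ℕ) : altSum V f (j + 1) = altSum V f j + (-1 : ℝ) ^ j *
    ∫ x, ((Real.sqrt (seqE V (j + 1) x))⁻¹ * seqF V f (j + 1) x) ^ 2 ∂gibbs V := by
  unfold altSum
  rw [Finset.sum_Icc_succ_top (by omega)]
  simp

end Sequences

/-! ### Solving the equations with finite energy. -/

/-- `y` is a finite energy solution of `(D* D + E) y = φ`. -/
structure IsEnergySolution (V E φ y : ℝ → ℝ) : Prop where
  eq : ∀ x, deriv V x * deriv y x - deriv (deriv y) x + E x * y x = φ x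
  memLp_deriv : MemLp (deriv y) 2 (gibbs V)
  memLp_sqrt_mul : MemLp (fun x => Real.sqrt (E x) * y x) 2 (gibbs V)

/-- The solution of `D* h = w` for `w` of zero mean. -/
theorem exists_dstar_eq {V : ℝ → ℝ} (hV : ContDiff ℝ 1 V) {m : ℕ}
    (hVm : ContDiff ℝ ((m + 1 : ℕ) : WithTop ℕ∞) V)
    {w : ℝ → ℝ} (hw : ContDiff ℝ (m : WithTop ℕ∞) w) (hwi : Integrable w (gibbs V))
    (hw0 : ∫ x, w x ∂gibbs V = 0) :
    ∃ h : ℝ → ℝ, ContDiff ℝ ((m + 1 : ℕ) : WithTop ℕ∞) h ∧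
      (∀ x, deriv V x * h x - deriv h x = w x) ∧
      Tendsto (fun x => Real.exp (-V x) * h x) (cocompact ℝ) (nhds 0) := by
  let r : ℝ → ℝ := fun x => Real.exp (-V x) * w x
  have hr : ContDiff ℝ (m : WithTop ℕ∞) r :=
    ((contDiff_of_nat_le hVm (Nat.le_succ m)).neg.exp).mul hw
  have hri : Integrable r := (integrable_gibbs_iff hV.continuous).1 hwi
  have hr0 : ∫ x, r x = 0 := by rw [← hw0, integral_gibbs hV.continuous]
  -- `I` is the primitive of `e^{-V} w` vanishing at `-∞`; zero mean makes it vanish at `+∞` too.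
  -- The solution is `h = -e^V I`, so its flux is `-I`.
  let I : ℝ → ℝ := fun x => (∫ t in (0 : ℝ)..x, r t) + ∫ t in Set.Iic 0, r t
  have hI : ∀ x, HasDerivAt I (r x) x := fun x =>
    (hr.continuous.integral_hasStrictDerivAt 0 x).hasDerivAt.add_const _
  have hIc : ContDiff ℝ ((m + 1 : ℕ) : WithTop ℕ∞) I := by
    push_cast
    rw [contDiff_succ_iff_deriv]
    refine ⟨fun x => (hI x).differentiableAt, by simp, ?_⟩
    rwa [show deriv I = r from funext fun x => (hI x).deriv]
  have hIt : Tendsto I (cocompact ℝ) (nhds 0) := by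
    rw [cocompact_eq_atBot_atTop, tendsto_sup]
    constructor
    · have h1 := intervalIntegral_tendsto_integral_Iic (f := r) (μ := volume) 0
        hri.integrableOn tendsto_id
      have h2 := h1.neg.add_const (∫ t in Set.Iic 0, r t)
      rw [neg_add_cancel] at h2
      refine h2.congr fun x => ?_
      simp only [I, id]
      rw [intervalIntegral.integral_symm 0 x]
      simp
    · have h1 := intervalIntegral_tendsto_integral_Ioi (f := r) (μ := volume) 0
        hri.integrableOn tendsto_id
      have h2 := h1.add_const (∫ t in Set.Iic 0, r t)
      have h3 : (∫ t in Set.Ioi 0, r t) + ∫ t in Set.Iic 0, r t = 0 := by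
        rw [add_comm, intervalIntegral.integral_Iic_add_Ioi hri.integrableOn hri.integrableOn, hr0]
      rwa [h3] at h2
  have hee : ∀ x, Real.exp (V x) * Real.exp (-V x) = 1 := fun x => by
    rw [← Real.exp_add]; simp
  refine ⟨fun x => -(Real.exp (V x) * I x), ((hVm.exp).mul hIc).neg, fun x => ?_, ?_⟩
  · have d1 := (hV.differentiable one_ne_zero x).hasDerivAt
    have d2 : deriv (fun x => -(Real.exp (V x) * I x)) x = _ := (d1.exp.mul (hI x)).neg.deriv
    rw [d2]
    simp only [r]
    linear_combination (w x) * hee x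
  · have h2 := hIt.neg
    rw [neg_zero] at h2
    refine h2.congr fun x => ?_
    linear_combination (I x) * hee x

section Solutions

variable {V : ℝ → ℝ} [IsProbabilityMeasure (gibbs V)]

/-- Conjugation by `a = E^{-1/2}` turns the equation of `c + D E⁻¹ D*` into that of
`D* D + c E + potential`. -/
theorem isEnergySolution_mul {a u g : ℝ → ℝ} (hV : ContDiff ℝ 2 V) (ha : ContDiff ℝ 2 a)
    (ha0 : ∀ x, 0 < a x) (hu : ContDiff ℝ 2 u) {c : ℝ} (hc : 0 ≤ c)
    (hF : ∀ x, 0 ≤ c / a x ^ 2 + potential V a x)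
    (hs : Tendsto (fun x => Real.exp (-V x) * u x) (cocompact ℝ) (nhds 0))
    (h1 : Integrable (fun x => c * u x ^ 2) (gibbs V))
    (h2 : Integrable (fun x => (a x * (deriv V x * u x - deriv u x)) ^ 2) (gibbs V))
    (heq : ∀ x, c * u x + deriv (fun x => a x ^ 2 * (deriv V x * u x - deriv u x)) x = g x) :
    IsEnergySolution V (fun x => c / a x ^ 2 + potential V a x) (fun x => (a x)⁻¹ * g x)
      (fun x => a x * u x) := by
  have hane : ∀ x, a x ≠ 0 := fun x => (ha0 x).ne'
  have ha' : ContDiff ℝ 1 (deriv a) := (contDiff_succ_iff_deriv (n := 1).1 ha).2.2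
  have hu' : ContDiff ℝ 1 (deriv u) := (contDiff_succ_iff_deriv (n := 1).1 hu).2.2
  have hV' : ContDiff ℝ 1 (deriv V) := (contDiff_succ_iff_deriv (n := 1).1 hV).2.2
  have d1 := fun x => (ha.differentiable two_ne_zero x).hasDerivAt
  have d2 := fun x => (ha'.differentiable one_ne_zero x).hasDerivAt
  have d3 := fun x => (hV'.differentiable one_ne_zero x).hasDerivAt
  have d4 := fun x => (hu.differentiable two_ne_zero x).hasDerivAt
  have d5 := fun x => (hu'.differentiable one_ne_zero x).hasDerivAt
  have hq : ContDiff ℝ 1 (fun x => a x * u x) := (ha.mul hu).of_le one_le_two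
  have cF : Continuous fun x => c / a x ^ 2 + potential V a x := by
    have c1 := ha'.continuous
    have c2 := hV'.continuous
    have c3 := ha'.continuous_deriv le_rfl
    have c4 := hV'.continuous_deriv le_rfl
    have c5 := ha.continuous
    unfold potential
    exact (continuous_const.div (c5.pow 2) fun x => pow_ne_zero 2 (hane x)).add
      (Continuous.div (by fun_prop) c5 hane)
  have hint := integrable_energy_of_flux hV ha ha0 (hu.of_le one_le_two) hc hF hs h1 h2
  refine ⟨fun x => ?_, ?_, ?_⟩
  · have e1 : deriv (fun x => a x * u x) = fun x => deriv a x * u x + a x * deriv u x :=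
      funext fun x => ((d1 x).mul (d4 x)).deriv
    have e2 : deriv (fun x => deriv a x * u x + a x * deriv u x) x = _ :=
      (((d2 x).mul (d4 x)).add ((d1 x).mul (d5 x))).deriv
    have e3 : deriv (fun x => a x ^ 2 * (deriv V x * u x - deriv u x)) x = _ :=
      (((d1 x).fun_pow 2).mul (((d3 x).mul (d4 x)).sub (d5 x))).deriv
    rw [e1, e2, ← heq, e3]
    simp only [potential, Pi.sub_apply, Pi.mul_apply]
    have := hane x
    field_simp
    push_cast
    ring
  · rw [memLp_two_iff_integrable_sq (hq.continuous_deriv le_rfl).aestronglyMeasurable]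
    refine hint.mono' ((hq.continuous_deriv le_rfl).pow 2).aestronglyMeasurable
      (Eventually.of_forall fun x => ?_)
    rw [Real.norm_of_nonneg (sq_nonneg _)]
    exact le_add_of_nonneg_right (mul_nonneg (hF x) (sq_nonneg _))
  · have hm : Continuous fun x => Real.sqrt (c / a x ^ 2 + potential V a x) * (a x * u x) :=
      cF.sqrt.mul hq.continuous
    rw [memLp_two_iff_integrable_sq hm.aestronglyMeasurable]
    refine hint.mono' (hm.pow 2).aestronglyMeasurable (Eventually.of_forall fun x => ?_)
    rw [Real.norm_of_nonneg (sq_nonneg _), mul_pow, Real.sq_sqrt (hF x)]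
    exact le_add_of_nonneg_left (sq_nonneg _)

end Solutions

/-! ### The chain of equations and the expansion of the variance. -/

section Chain

variable {n : ℕ} {V f : ℝ → ℝ} [IsProbabilityMeasure (gibbs V)]

/-- Take `D* y = f - ∫ f dμ`. Then `D D* y = f'` is the required equation by the commutation `D D* =
D* D + V''`, and `Var f = ⟨f, D* y⟩ = ⟨f', y⟩`. -/
theorem exists_energySolution_one (hn : 1 ≤ n)
    (hV : ContDiff ℝ ((2 * n + 1 : ℕ) : WithTop ℕ∞) V)
    (hE : ∀ x : ℝ, 0 < seqE V 1 x)
    (hf : ContDiff ℝ ((n + 1 : ℕ) : WithTop ℕ∞) f) (hfc : HasCompactSupport f) :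
    ∃ y : ℝ → ℝ, ContDiff ℝ ((n + 2 : ℕ) : WithTop ℕ∞) y ∧
      IsEnergySolution V (seqE V 1) (seqF V f 1) y ∧
      ProbabilityTheory.variance f (gibbs V) = ∫ x, y x * seqF V f 1 x ∂gibbs V := by
  have hV2 : ContDiff ℝ 2 V := contDiff_of_nat_le (m := 2) hV (by omega)
  have hV1 : ContDiff ℝ 1 V := hV2.of_le one_le_two
  have hf1 : ContDiff ℝ 1 f := contDiff_of_nat_le (m := 1) hf (by omega)
  have hfm : MemLp f 2 (gibbs V) := hf.continuous.memLp_of_hasCompactSupport hfc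
  have hfi : Integrable f (gibbs V) := hfm.integrable one_le_two
  set m : ℝ := ∫ x, f x ∂gibbs V with hm
  have hwm : MemLp (fun x => f x - m) 2 (gibbs V) := hfm.sub (memLp_const m)
  have hw0 : ∫ x, (f x - m) ∂gibbs V = 0 := by
    rw [integral_sub hfi (integrable_const m)]
    simp [hm]
  obtain ⟨h, hh, heq, hs⟩ := exists_dstar_eq hV1 (m := n + 1) (contDiff_of_nat_le hV (by omega))
    (hf.sub contDiff_const) (hwm.integrable one_le_two) hw0
  have hh2 : ContDiff ℝ 2 h := contDiff_of_nat_le (m := 2) hh (by omega)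
  refine ⟨h, hh, ?_, ?_⟩
  · have hpot : ∀ x, (0 : ℝ) / (1 : ℝ) ^ 2 + potential V (fun _ => 1) x = seqE V 1 x := by
      intro x
      simp [potential, seqE]
    -- With `a = 1` and `c = 0` the conjugation is trivial and the potential is `V''`.
    have := isEnergySolution_mul (a := fun _ => 1) (u := h) (g := deriv f) (c := 0) hV2
      contDiff_const (fun _ => one_pos) hh2 le_rfl (fun x => (hpot x).symm ▸ (hE x).le) hs
      (by simp) ?_ ?_
    · simp only [hpot, inv_one, one_mul] at this
      exact this
    · simp only [one_mul, heq]
      exact hwm.integrable_sq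
    · intro x
      simp only [one_pow, one_mul, heq, zero_mul, zero_add]
      rw [deriv_sub_const]
  · have hparts := integral_deriv_mul_gibbs hV1 hf1 (hh2.of_le one_le_two) hfc
    simp only [heq] at hparts
    rw [ProbabilityTheory.variance_eq_sub hfm]
    calc _ = ∫ x, f x * (f x - m) ∂gibbs V := by
          have e1 : ∫ x, f x * (f x - m) ∂gibbs V = ∫ x, (f x ^ 2 - m * f x) ∂gibbs V := by
            refine integral_congr_ae (Eventually.of_forall fun x => ?_)
            simp only
            ring
          rw [e1, integral_sub hfm.integrable_sq (hfi.const_mul m), integral_const_mul, ← hm]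
          simp only [Pi.pow_apply]
          ring
      _ = ∫ x, h x * seqF V f 1 x ∂gibbs V := by
          rw [← hparts]
          refine integral_congr_ae (Eventually.of_forall fun x => ?_)
          simp only [seqF]
          ring

variable {E φ y : ℝ → ℝ}

/-- `a D* D y` is in `L²(μ)` for a solution `y` of finite energy, where `a = E^{-1/2}`. -/
theorem IsEnergySolution.memLp_inv_sqrt_mul_dstar (hy : IsEnergySolution V E φ y)
    (hE : Continuous E) (hE0 : ∀ x, 0 < E x) (hφ : Continuous φ) (hφc : HasCompactSupport φ) :
    MemLp (fun x => (Real.sqrt (E x))⁻¹ * (deriv V x * deriv y x - deriv (deriv y) x)) 2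
      (gibbs V) := by
  have hc : Continuous fun x => (Real.sqrt (E x))⁻¹ * φ x :=
    (hE.sqrt.inv₀ fun x => (Real.sqrt_pos.2 (hE0 x)).ne').mul hφ
  have h1 : MemLp (fun x => (Real.sqrt (E x))⁻¹ * φ x) 2 (gibbs V) :=
    hc.memLp_of_hasCompactSupport hφc.mul_left
  -- By the equation, `E^{-1/2} D* D y = E^{-1/2} φ - E^{1/2} y`.
  refine (h1.sub hy.memLp_sqrt_mul).ae_eq (Eventually.of_forall fun x => ?_)
  have h2 := Real.sqrt_pos.2 (hE0 x)
  have h3 := Real.sq_sqrt (hE0 x).le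
  have h4 := hy.eq x
  simp only [Pi.sub_apply]
  field_simp
  rw [h3, ← h4]
  ring

/-- Outside the support of `φ`, the pair `y`, `s = e^{-V} y'` solves `y' = e^V s`, `s' = e^{-V} E
y`. Here `e^{-V}` is integrable and `∫ e^V s² dx = ‖y'‖²` is finite, so the decay lemma applies. -/
theorem IsEnergySolution.tendsto_flux (hy : IsEnergySolution V E φ y) (hV : ContDiff ℝ 1 V)
    (hy2 : ContDiff ℝ 2 y) (hE0 : ∀ x, 0 < E x) (hφc : HasCompactSupport φ) :
    Tendsto (fun x => Real.exp (-V x) * deriv y x) (cocompact ℝ) (nhds 0) := by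
  have hy' : ContDiff ℝ 1 (deriv y) := (contDiff_succ_iff_deriv (n := 1).1 hy2).2.2
  obtain ⟨a, ha⟩ : ∃ a, ∀ x : ℝ, a < |x| → φ x = 0 := by
    obtain ⟨a, ha⟩ := hφc.isCompact.isBounded.subset_closedBall (0 : ℝ)
    refine ⟨a, fun x hx => ?_⟩
    by_contra h0
    have := ha (subset_tsupport _ (Function.mem_support.2 h0))
    rw [Metric.mem_closedBall, Real.dist_eq, sub_zero] at this
    exact absurd this (not_le.2 hx)
  have hee : ∀ x, Real.exp (V x) * Real.exp (-V x) = 1 := fun x => by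
    rw [← Real.exp_add]; simp
  refine tendsto_flux_cocompact (ρ := fun x => Real.exp (V x))
    (κ := fun x => Real.exp (-V x) * E x) (y := y) (a := a) (fun x => Real.exp_pos _) ?_
    (Real.continuous_exp.comp hV.continuous) (fun x => mul_nonneg (Real.exp_pos _).le (hE0 x).le)
    (fun x => ?_) (fun x hx => ?_) ?_
  · have := (integrable_gibbs_iff hV.continuous).1 (integrable_const (1 : ℝ))
    simpa [Real.exp_neg] using this
  · refine (hy2.differentiable two_ne_zero x).hasDerivAt.congr_deriv ?_
    linear_combination (-deriv y x) * hee x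
  · have d1 := (hV.differentiable one_ne_zero x).hasDerivAt
    have d2 := (hy'.differentiable one_ne_zero x).hasDerivAt
    refine (d1.neg.exp.mul d2).congr_deriv ?_
    have h1 := hy.eq x
    rw [ha x hx] at h1
    simp only [Pi.neg_apply]
    linear_combination (-Real.exp (-V x)) * h1
  · have h1 := (integrable_gibbs_iff hV.continuous).1 hy.memLp_deriv.integrable_sq
    refine h1.congr (Eventually.of_forall fun x => ?_)
    simp only
    linear_combination (-Real.exp (-V x) * deriv y x ^ 2) * hee x

/-- `⟨y, φ⟩ = ‖E^{-1/2} φ‖² - ⟨y', D[E⁻¹ φ]⟩` for `(D* D + E) y = φ`. -/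
theorem IsEnergySolution.integral_mul_eq (hy : IsEnergySolution V E φ y) (hV : ContDiff ℝ 1 V)
    (hy2 : ContDiff ℝ 2 y) (hE : ContDiff ℝ 1 E) (hE0 : ∀ x, 0 < E x) (hφ : ContDiff ℝ 1 φ)
    (hφc : HasCompactSupport φ) :
    ∫ x, y x * φ x ∂gibbs V = ∫ x, ((Real.sqrt (E x))⁻¹ * φ x) ^ 2 ∂gibbs V -
      ∫ x, deriv y x * deriv (fun x => (E x)⁻¹ * φ x) x ∂gibbs V := by
  have hy' : ContDiff ℝ 1 (deriv y) := (contDiff_succ_iff_deriv (n := 1).1 hy2).2.2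
  have hEinv : ContDiff ℝ 1 fun x => (E x)⁻¹ := hE.inv fun x => (hE0 x).ne'
  -- Integration by parts moves `D` from `E⁻¹ φ` to `y'`, producing `D* D y = φ - E y`.
  have h := integral_deriv_mul_gibbs hV (hEinv.mul hφ) hy' hφc.mul_left
  have hcomm : ∫ x, deriv y x * deriv (fun x => (E x)⁻¹ * φ x) x ∂gibbs V =
      ∫ x, deriv (fun x => (E x)⁻¹ * φ x) x * deriv y x ∂gibbs V :=
    integral_congr_ae (Eventually.of_forall fun x => mul_comm _ _)
  rw [hcomm, h, ← integral_sub]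
  · refine integral_congr_ae (Eventually.of_forall fun x => ?_)
    have h1 := (hE0 x).ne'
    have h2 : deriv V x * deriv y x - deriv (deriv y) x = φ x - E x * y x := by
      linear_combination hy.eq x
    simp only
    rw [h2, mul_pow, inv_pow, Real.sq_sqrt (hE0 x).le]
    field_simp
    ring
  · have hc : Continuous fun x => (Real.sqrt (E x))⁻¹ * φ x :=
      (hE.continuous.sqrt.inv₀ fun x => (Real.sqrt_pos.2 (hE0 x)).ne').mul hφ.continuous
    exact (hc.memLp_of_hasCompactSupport (p := 2) hφc.mul_left).integrable_sq
  · have c1 := hV.continuous_deriv le_rfl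
    have c2 := hy'.continuous
    have c3 := hy'.continuous_deriv le_rfl
    have c4 := hEinv.continuous
    have c5 := hφ.continuous
    exact integrable_gibbs_of_hasCompactSupport (by fun_prop) hφc.mul_left.mul_right

/-- Differentiating `E⁻¹ D* D y = E⁻¹ φ - y` gives `u + D E⁻¹ D* u = D[E⁻¹ φ]` for `u = y'`.
Conjugation by `E^{-1/2}` with `c = 1` yields the next equation; its finite-energy part rests on the
decay of the flux of `u`. -/
theorem IsEnergySolution.next (hy : IsEnergySolution V E φ y) (hV : ContDiff ℝ 2 V)
    (hy3 : ContDiff ℝ 3 y) (hE : ContDiff ℝ 2 E) (hE0 : ∀ x, 0 < E x) (hφ : ContDiff ℝ 1 φ)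
    (hφc : HasCompactSupport φ)
    (hF : ∀ x, 0 < E x * (1 + calA V (fun y => (E y)⁻¹) x)) :
    IsEnergySolution V (fun x => E x * (1 + calA V (fun y => (E y)⁻¹) x))
      (fun x => Real.sqrt (E x) * deriv (fun x => (E x)⁻¹ * φ x) x)
      (fun x => (Real.sqrt (E x))⁻¹ * deriv y x) := by
  have hV1 : ContDiff ℝ 1 V := hV.of_le one_le_two
  have hy2 : ContDiff ℝ 2 y := contDiff_of_nat_le (m := 2) (k := 3) hy3 (by omega)
  have hu : ContDiff ℝ 2 (deriv y) := contDiff_nat_deriv (m := 2) hy3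
  have ha := contDiff_inv_sqrt hE hE0
  have ha0 : ∀ x, 0 < (Real.sqrt (E x))⁻¹ := fun x => inv_pos.2 (Real.sqrt_pos.2 (hE0 x))
  have hsq : ∀ x, (Real.sqrt (E x))⁻¹ ^ 2 = (E x)⁻¹ := fun x => by
    rw [inv_pow, Real.sq_sqrt (hE0 x).le]
  have hpot : ∀ x, 1 / (Real.sqrt (E x))⁻¹ ^ 2 + potential V (fun x => (Real.sqrt (E x))⁻¹) x =
      E x * (1 + calA V (fun y => (E y)⁻¹) x) := by
    intro x
    have h1 := calA_sq (V := V) ha ha0 x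
    simp only [hsq] at h1
    rw [h1, hsq]
    have := (hE0 x).ne'
    field_simp
  have hmem := hy.memLp_inv_sqrt_mul_dstar hE.continuous hE0 hφ.continuous hφc
  have h := isEnergySolution_mul (g := deriv (fun x => (E x)⁻¹ * φ x)) (c := 1) hV ha ha0 hu
    zero_le_one (fun x => (hpot x).symm ▸ (hF x).le) (hy.tendsto_flux hV1 hy2 hE0 hφc)
    (by simpa using hy.memLp_deriv.integrable_sq) hmem.integrable_sq ?_
  · simp only [hpot, inv_inv] at h
    exact h
  · intro x
    have e1 : (fun x => (Real.sqrt (E x))⁻¹ ^ 2 *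
        (deriv V x * deriv y x - deriv (deriv y) x)) = fun x => (E x)⁻¹ * φ x - y x := by
      funext x
      have := (hE0 x).ne'
      rw [hsq, ← hy.eq x]
      field_simp
      ring
    have hd : DifferentiableAt ℝ (fun x => (E x)⁻¹ * φ x) x :=
      (((hE.of_le one_le_two).inv fun x => (hE0 x).ne').mul hφ).differentiable one_ne_zero x
    have e2 : deriv (fun x => (E x)⁻¹ * φ x - y x) x = _ :=
      deriv_fun_sub hd (hy2.differentiable two_ne_zero x)
    rw [e1, e2]
    ring

/-- The derivative of the solution of `(D* D + E) y = φ` is `(I + D E⁻¹ D*)⁻¹ D[E⁻¹ φ]`. -/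
theorem IsEnergySolution.isDEDstar (hy : IsEnergySolution V E φ y) (hV : ContDiff ℝ 1 V)
    (hy2 : ContDiff ℝ 2 y) (hE : ContDiff ℝ 1 E) (hE0 : ∀ x, 0 < E x) (hφ : ContDiff ℝ 1 φ)
    (hφc : HasCompactSupport φ) {u g : L2 V} (hu : u =ᵐ[gibbs V] deriv y)
    (hg : g =ᵐ[gibbs V] deriv fun x => (E x)⁻¹ * φ x) : IsDEDstar V E u (g - u) := by
  have hy' : ContDiff ℝ 1 (deriv y) := (contDiff_succ_iff_deriv (n := 1).1 hy2).2.2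
  have hy1 : ContDiff ℝ 1 y := hy2.of_le one_le_two
  have hψ : ContDiff ℝ 1 fun x => (E x)⁻¹ * φ x := (hE.inv fun x => (hE0 x).ne').mul hφ
  have hmem := hy.memLp_inv_sqrt_mul_dstar hE.continuous hE0 hφ.continuous hφc
  -- The intermediate vector has two forms: `E^{-1/2} D* y'`, which is `S* u`, and `E^{1/2} (E⁻¹ φ -
  -- y)`, which the closure of `S` maps to `D[E⁻¹ φ] - y'`.
  refine ⟨hmem.toLp, mem_graphS_adjoint hV hy' hu ?_,
    mem_graphS_adjoint_adjoint hE.continuous (hψ.sub hy1) ?_ ?_⟩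
  · filter_upwards [hmem.coeFn_toLp] with x hx
    rw [hx, mul_inv_cancel_left₀ (Real.sqrt_pos.2 (hE0 x)).ne']
  · filter_upwards [hmem.coeFn_toLp] with x hx
    rw [hx, ← hy.eq x]
    have h2 := Real.sqrt_pos.2 (hE0 x)
    have h3 := Real.sq_sqrt (hE0 x).le
    have h4 := (hE0 x).ne'
    field_simp
    rw [h3]
    ring
  · filter_upwards [Lp.coeFn_sub g u, hu, hg] with x hx hux hgx
    have e2 : deriv (fun x => (E x)⁻¹ * φ x - y x) x = _ :=
      deriv_fun_sub (hψ.differentiable one_ne_zero x) (hy1.differentiable one_ne_zero x)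
    rw [hx, e2, Pi.sub_apply, hux, hgx]

theorem exists_energySolution (hn : 1 ≤ n)
    (hV : ContDiff ℝ ((2 * n + 1 : ℕ) : WithTop ℕ∞) V)
    (hE : ∀ k ∈ Finset.Icc 1 n, ∀ x : ℝ, 0 < seqE V k x)
    (hf : ContDiff ℝ ((n + 1 : ℕ) : WithTop ℕ∞) f) (hfc : HasCompactSupport f)
    (j : ℕ) (hj : j + 1 ≤ n) :
    ∃ y : ℝ → ℝ, ContDiff ℝ ((n - (j + 1) + 3 : ℕ) : WithTop ℕ∞) y ∧
      IsEnergySolution V (seqE V (j + 1)) (seqF V f (j + 1)) y ∧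
      ProbabilityTheory.variance f (gibbs V) =
        altSum V f j + (-1) ^ j * ∫ x, y x * seqF V f (j + 1) x ∂gibbs V := by
  induction j with
  | zero =>
    obtain ⟨y, h1, h2, h3⟩ := exists_energySolution_one hn hV
      (hE 1 (Finset.mem_Icc.2 ⟨le_rfl, hn⟩)) hf hfc
    exact ⟨y, contDiff_of_nat_le h1 (by omega), h2, by simp [altSum, h3]⟩
  | succ j ih =>
    obtain ⟨y, h1, h2, h3⟩ := ih (by omega)
    have hV2 : ContDiff ℝ 2 V := contDiff_of_nat_le (m := 2) hV (by omega)
    have hE0 := hE (j + 1) (Finset.mem_Icc.2 ⟨by omega, by omega⟩)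
    have hE1 := hE (j + 2) (Finset.mem_Icc.2 ⟨by omega, by omega⟩)
    have hEr := contDiff_seqE hV hE j (by omega)
    have hE2 : ContDiff ℝ 2 (seqE V (j + 1)) := contDiff_of_nat_le (m := 2) hEr (by omega)
    have hF1 : ContDiff ℝ 1 (seqF V f (j + 1)) :=
      contDiff_of_nat_le (m := 1) (contDiff_seqF hV hE hf j (by omega)) (by omega)
    have hFc := hasCompactSupport_seqF (V := V) hfc (j + 1)
    have hy3 : ContDiff ℝ 3 y := contDiff_of_nat_le (m := 3) h1 (by omega)
    have hy2 : ContDiff ℝ 2 y := contDiff_of_nat_le (m := 2) h1 (by omega)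
    refine ⟨fun x => (Real.sqrt (seqE V (j + 1) x))⁻¹ * deriv y x, ?_,
      h2.next hV2 hy3 hE2 hE0 hF1 hFc hE1, ?_⟩
    · exact (contDiff_inv_sqrt (contDiff_of_nat_le hEr (by omega)) hE0).mul
        (contDiff_nat_deriv (contDiff_of_nat_le h1 (by omega)))
    -- The factors `E_k^{-1/2}` and `E_k^{1/2}` cancel, so the remainder `⟨y_k', D[E_k⁻¹ f_k]⟩` is
    -- `⟨y_{k+1}, f_{k+1}⟩`.
    · have e1 : ∫ x, (Real.sqrt (seqE V (j + 1) x))⁻¹ * deriv y x * seqF V f (j + 2) x ∂gibbs V =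
          ∫ x, deriv y x *
            deriv (fun x => (seqE V (j + 1) x)⁻¹ * seqF V f (j + 1) x) x ∂gibbs V := by
        refine integral_congr_ae (Eventually.of_forall fun x => ?_)
        have := (Real.sqrt_pos.2 (hE0 x)).ne'
        simp only [seqF]
        field_simp
      rw [h3, h2.integral_mul_eq (hV2.of_le one_le_two) hy2 (hE2.of_le one_le_two) hE0 hF1 hFc,
        e1, altSum_succ]
      ring

end Chain

end BrascampLieb

/-! ### The theorem. -/

theorem mainTheorem1 (n : ℕ) (hn : 1 ≤ n) (V : ℝ → ℝ)
    (hV : ContDiff ℝ ((2 * n + 1 : ℕ) : WithTop ℕ∞) V)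
    (hμ : IsProbabilityMeasure (BrascampLieb.gibbs V))
    (hE : ∀ k ∈ Finset.Icc 1 n, ∀ x : ℝ, 0 < BrascampLieb.seqE V k x) :
    ∃ R : BrascampLieb.L2 V →L[ℝ] BrascampLieb.L2 V,
      BrascampLieb.IsInverse V (BrascampLieb.seqE V n) R ∧
      ∀ f : ℝ → ℝ, ContDiff ℝ ((n + 1 : ℕ) : WithTop ℕ∞) f → HasCompactSupport f →
        (∀ k ∈ Finset.Icc 1 n,
          MemLp (fun x => (Real.sqrt (BrascampLieb.seqE V k x))⁻¹ * BrascampLieb.seqF V f k x) 2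
            (BrascampLieb.gibbs V)) ∧
        (∃ g : BrascampLieb.L2 V,
          (g =ᵐ[BrascampLieb.gibbs V] BrascampLieb.remF V f n) ∧
          ProbabilityTheory.variance f (BrascampLieb.gibbs V) =
            BrascampLieb.altSum V f n + (-1 : ℝ) ^ n * inner ℝ (R g) g) ∧
        (Even n → BrascampLieb.altSum V f n ≤
          ProbabilityTheory.variance f (BrascampLieb.gibbs V)) ∧
        (Odd n → ProbabilityTheory.variance f (BrascampLieb.gibbs V) ≤
          BrascampLieb.altSum V f n) := by
  obtain ⟨R, hR, hR0⟩ := exists_inverse_one_add_adjoint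
    (BrascampLieb.graphS V (BrascampLieb.seqE V n))
  refine ⟨R, hR, fun f hf hfc => ?_⟩
  have hmem : ∀ k ∈ Finset.Icc 1 n,
      MemLp (fun x => (Real.sqrt (BrascampLieb.seqE V k x))⁻¹ * BrascampLieb.seqF V f k x) 2
        (BrascampLieb.gibbs V) := by
    intro k hk
    obtain ⟨j, rfl⟩ : ∃ j, k = j + 1 := ⟨k - 1, by have := Finset.mem_Icc.1 hk; omega⟩
    have hj := (Finset.mem_Icc.1 hk).2
    have h1 := BrascampLieb.contDiff_inv_sqrt (BrascampLieb.contDiff_seqE hV hE j hj) (hE _ hk)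
    exact (h1.continuous.mul (BrascampLieb.contDiff_seqF hV hE hf j hj).continuous
      ).memLp_of_hasCompactSupport (BrascampLieb.hasCompactSupport_seqF hfc _).mul_left
  have hvar : ∃ g : BrascampLieb.L2 V, (g =ᵐ[BrascampLieb.gibbs V] BrascampLieb.remF V f n) ∧
      ProbabilityTheory.variance f (BrascampLieb.gibbs V) =
        BrascampLieb.altSum V f n + (-1 : ℝ) ^ n * inner ℝ (R g) g := by
    obtain ⟨j, rfl⟩ : ∃ j, n = j + 1 := ⟨n - 1, by omega⟩
    have hV1 : ContDiff ℝ 1 V := BrascampLieb.contDiff_of_nat_le (m := 1) hV (by omega)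
    have hE0 := hE (j + 1) (Finset.mem_Icc.2 ⟨by omega, le_rfl⟩)
    have hE1 : ContDiff ℝ 1 (BrascampLieb.seqE V (j + 1)) := BrascampLieb.contDiff_of_nat_le
      (m := 1) (BrascampLieb.contDiff_seqE hV hE j le_rfl) (by omega)
    have hF1 : ContDiff ℝ 1 (BrascampLieb.seqF V f (j + 1)) := BrascampLieb.contDiff_of_nat_le
      (m := 1) (BrascampLieb.contDiff_seqF hV hE hf j le_rfl) (by omega)
    have hFc := BrascampLieb.hasCompactSupport_seqF (V := V) hfc (j + 1)
    obtain ⟨y, hyc, hy, hyv⟩ := BrascampLieb.exists_energySolution hn hV hE hf hfc j le_rfl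
    have hy2 : ContDiff ℝ 2 y := BrascampLieb.contDiff_of_nat_le (m := 2) hyc (by omega)
    have hgm : MemLp (BrascampLieb.remF V f (j + 1)) 2 (BrascampLieb.gibbs V) :=
      (((hE1.inv fun x => (hE0 x).ne').mul hF1).continuous_deriv le_rfl).memLp_of_hasCompactSupport
        hFc.mul_left.deriv
    -- The last equation is not conjugated, so `E_{n+1}` and its sign play no role; `y_n'` is read
    -- off as the value of the inverse.
    have hRg : R hgm.toLp = hy.memLp_deriv.toLp :=
      (hR _ _).2 (hy.isDEDstar hV1 hy2 hE1 hE0 hF1 hFc hy.memLp_deriv.coeFn_toLp hgm.coeFn_toLp)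
    have hin : inner ℝ (R hgm.toLp) hgm.toLp =
        ∫ x, deriv y x * BrascampLieb.remF V f (j + 1) x ∂BrascampLieb.gibbs V := by
      rw [hRg, BrascampLieb.inner_L2_eq]
      refine integral_congr_ae ?_
      filter_upwards [hgm.coeFn_toLp, hy.memLp_deriv.coeFn_toLp] with x h1 h2
      rw [h1, h2]
    refine ⟨hgm.toLp, hgm.coeFn_toLp, ?_⟩
    rw [hin, hyv, hy.integral_mul_eq hV1 hy2 hE1 hE0 hF1 hFc, BrascampLieb.altSum_succ]
    simp only [BrascampLieb.remF]
    ring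
  refine ⟨hmem, hvar, fun hev => ?_, fun hod => ?_⟩
  · obtain ⟨g, -, hg⟩ := hvar
    rw [hg, hev.neg_one_pow]
    linarith [hR0 g]
  · obtain ⟨g, -, hg⟩ := hvar
    rw [hg, hod.neg_one_pow]
    linarith [hR0 g]
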